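/- Let $\mathbb F$ be a field, let $k$ be an odd positive integer, and let $\mathbb S^1=\mathbb R/2\pi\mathbb Z$ carry its geodesic distance (so its diameter is $\pi$). For a finite metric space $Y$ and $r\in\mathbb R$, let $\mathrm{VR}_r(Y)$ be the Vietoris–Rips complex, whose faces are the nonempty finite subsets of $Y$ of diameter at most $r$. The degree-$k$ persistence diagram $\mathrm{dgm}_k^{\mathrm{VR}}(Y)$ is the finite multiset $D$ of points $(b,d)$, $b<d\le\infty$, such that the persistence module $r\mapsto H_k(\mathrm{VR}_r(Y);\mathbb F)$ is isomorphic to $\bigoplus_{(b,d)\in D}\mathbb F_{[b,d)}$, where $\mathbb F_{[b,d)}$ denotes the interval module supported on $[b,d)$. Let $$\mathbf D^{\mathrm{VR}}_{n,k}(\mathbb S^1)=\{\mathrm{dgm}_k^{\mathrm{VR}}(Y): Y\subseteq \mathbb S^1,\ |Y|\le n\}.$$ A point $(t_b,t_d)$ with $t_b\le t_d$ represents the one-point diagram $\{(t_b,t_d)\}$ if $t_b<t_d$, and the empty diagram if $t_b=t_d$. **Theorem.** With this convention, $\mathbf D^{\mathrm{VR}}_{2k+2,k}(\mathbb S^1)$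 is exactly the set of diagrams represented by the points of $$\{(t_b,t_d)\in\mathbb R^2 : (k+1)(\pi-t_b)\le t_d\le \pi \ \text{ and }\ t_b\le t_d\}.$$ In particular, the one-point diagrams in $\mathbf D^{\mathrm{VR}}_{2k+2,k}(\mathbb S^1)$ are exactly the $\{(t_b,t_d)\}$ with $(k+1)(\pi-t_b)\le t_d\le\pi$ and $t_b<t_d$. For $k=1$ these $(t_b,t_d)$ are exactly the points, off the diagonal $t_b=t_d$, of the closed triangle with vertices $(\tfrac{2\pi}{3},\tfrac{2\pi}{3})$, $(\tfrac{\pi}{2},\pi)$ and $(\pi,\pi)$. -/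

import Mathlib

/-! ## Vietoris–Rips complexes and simplicial homology -/

/-- The Vietoris–Rips complex of a metric space `Y` at scale `r`: its faces are the nonempty finite
sets of diameter at most `r`. -/
def vietorisRips (Y : Type*) [PseudoMetricSpace Y] (r : ℝ) : PreAbstractSimplicialComplex Y where
  faces := {σ | σ.Nonempty ∧ Metric.diam (σ : Set Y) ≤ r}
  isRelLowerSet_faces := fun _σ hσ => ⟨hσ.1, fun _τ hτ hne =>
    ⟨hne, (Metric.diam_mono (Finset.coe_subset.mpr hτ) (Finset.finite_toSet _).isBounded).trans
      hσ.2⟩⟩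

theorem vietorisRips_mono (Y : Type*) [PseudoMetricSpace Y] {r s : ℝ} (h : r ≤ s) :
    vietorisRips Y r ≤ vietorisRips Y s :=
  fun _σ hσ => ⟨hσ.1, hσ.2.trans h⟩

namespace PreAbstractSimplicialComplex

/-- Ordered simplicial `n`-chains of `K` with coefficients in `F`: the free module on the tuples
`(v₀, …, vₙ)` of vertices that all lie in a common face of `K` (equivalently, since `K` is closed
under nonempty subsets, whose set of entries is a face). It is realized as a submodule of the free
module on all `(n+1)`-tuples. -/
def chains (F : Type*) [Field F] {V : Type*} (K : PreAbstractSimplicialComplex V) (n : ℕ) :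
    Submodule F ((Fin (n + 1) → V) →₀ F) :=
  Finsupp.supported F F {v | ∃ σ ∈ K.faces, ∀ i, v i ∈ σ}

/-- The simplicial boundary `∂ (v₀, …, vₙ₊₁) = ∑ᵢ (-1)ⁱ (v₀, …, v̂ᵢ, …, vₙ₊₁)`. -/
noncomputable def boundary (F : Type*) [Field F] (V : Type*) (n : ℕ) :
    ((Fin (n + 2) → V) →₀ F) →ₗ[F] ((Fin (n + 1) → V) →₀ F) :=
  ∑ i : Fin (n + 2), (-1 : F) ^ (i : ℕ) •
    Finsupp.lmapDomain F F (fun (v : Fin (n + 2) → V) (j : Fin (n + 1)) => v (i.succAbove j))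

/-- Simplicial `n`-cycles; every `0`-chain is a cycle. -/
noncomputable def cycles (F : Type*) [Field F] {V : Type*} (K : PreAbstractSimplicialComplex V) :
    (n : ℕ) → Submodule F ((Fin (n + 1) → V) →₀ F)
  | 0 => K.chains F 0
  | n + 1 => K.chains F (n + 1) ⊓ LinearMap.ker (boundary F V n)

/-- Simplicial `n`-boundaries. -/
noncomputable def boundaries (F : Type*) [Field F] {V : Type*} (K : PreAbstractSimplicialComplex V)
    (n : ℕ) : Submodule F ((Fin (n + 1) → V) →₀ F) :=
  (K.chains F (n + 1)).map (boundary F V n)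

/-- The usual additive group of cycles, registered because instance search does not find it
through `Finsupp`. -/
noncomputable instance instAddCommGroupCycles (F : Type*) [Field F] {V : Type*}
    (K : PreAbstractSimplicialComplex V) (n : ℕ) : AddCommGroup (K.cycles F n) :=
  Submodule.addCommGroup _

/-- Simplicial homology `Hₙ(K; F)`, cycles modulo boundaries. -/
abbrev Homology (F : Type*) [Field F] {V : Type*} (K : PreAbstractSimplicialComplex V) (n : ℕ) :=
  K.cycles F n ⧸ (K.boundaries F n).submoduleOf (K.cycles F n)

theorem chains_mono (F : Type*) [Field F] {V : Type*} {K L : PreAbstractSimplicialComplex V}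
    (h : K ≤ L) (n : ℕ) : K.chains F n ≤ L.chains F n :=
  Finsupp.supported_mono fun _ ⟨σ, hσ, hv⟩ => ⟨σ, h hσ, hv⟩

theorem cycles_mono (F : Type*) [Field F] {V : Type*} {K L : PreAbstractSimplicialComplex V}
    (h : K ≤ L) : ∀ n : ℕ, K.cycles F n ≤ L.cycles F n
  | 0 => chains_mono F h 0
  | n + 1 => inf_le_inf_right _ (chains_mono F h (n + 1))

theorem boundaries_mono (F : Type*) [Field F] {V : Type*} {K L : PreAbstractSimplicialComplex V}
    (h : K ≤ L) (n : ℕ) : K.boundaries F n ≤ L.boundaries F n :=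
  Submodule.map_mono (chains_mono F h (n + 1))

/-- The map induced on homology by an inclusion of complexes. -/
noncomputable def homologyMap (F : Type*) [Field F] {V : Type*}
    {K L : PreAbstractSimplicialComplex V} (h : K ≤ L) (n : ℕ) :
    K.Homology F n →ₗ[F] L.Homology F n :=
  Submodule.mapQ _ _ (Submodule.inclusion (cycles_mono F h n))
    fun _ hx => boundaries_mono F h n hx

end PreAbstractSimplicialComplex

/-! ## Persistence modules and persistence diagrams -/

/-- A persistence module over `F`: vector spaces indexed by the real scale parameter, with
functorial structure maps. -/
structure PersistenceModule.{u, v} (F : Type u) [Field F] where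
  space : ℝ → Type v
  [addCommGroup : ∀ r, AddCommGroup (space r)]
  [module : ∀ r, Module F (space r)]
  map : ∀ {r s : ℝ}, r ≤ s → space r →ₗ[F] space s
  map_self : ∀ (r : ℝ) (x : space r), map (le_refl r) x = x
  map_map : ∀ {r s t : ℝ} (hrs : r ≤ s) (hst : s ≤ t) (x : space r),
    map hst (map hrs x) = map (hrs.trans hst) x

attribute [instance] PersistenceModule.addCommGroup PersistenceModule.module

namespace PersistenceModule

/-- Isomorphisms of persistence modules: linear equivalences at every scale, compatible with the
structure maps. -/
structure Iso.{u, v, w} {F : Type u} [Field F] (V : PersistenceModule.{u, v} F)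
    (W : PersistenceModule.{u, w} F) where
  equiv : ∀ r, V.space r ≃ₗ[F] W.space r
  comm : ∀ {r s : ℝ} (h : r ≤ s) (x : V.space r),
    equiv s (V.map h x) = W.map h (equiv r x)

/-- The direct sum of finitely many persistence modules. -/
noncomputable def directSum.{u, v} {F : Type u} [Field F] {m : ℕ} (V : Fin m → PersistenceModule.{u, v} F) :
    PersistenceModule.{u, v} F where
  space r := ∀ i, (V i).space r
  map h := LinearMap.pi fun i => ((V i).map h).comp (LinearMap.proj i)
  map_self r x := funext fun i => (V i).map_self r (x i)
  map_map hrs hst x := funext fun i => (V i).map_map hrs hst (x i)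

open Classical in
/-- The space of the interval module `[b, d)` at scale `r`: all of `F` if `b ≤ r < d`, else `0`. -/
noncomputable def intervalSpace (F : Type*) [Field F] (b : ℝ) (d : WithTop ℝ) (r : ℝ) : Submodule F F :=
  if b ≤ r ∧ (r : WithTop ℝ) < d then ⊤ else ⊥

open Classical in
/-- The linear map from `F` onto the space of the interval module at scale `r`: the identity if
`b ≤ r < d`, and `0` otherwise. -/
noncomputable def toIntervalSpace (F : Type*) [Field F] (b : ℝ) (d : WithTop ℝ) (r : ℝ) :
    F →ₗ[F] intervalSpace F b d r :=
  if h : b ≤ r ∧ (r : WithTop ℝ) < d then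
    LinearMap.id.codRestrict (intervalSpace F b d r) fun x => by simp [intervalSpace, h]
  else 0

/-- The interval module `[b, d)`: one copy of `F` at each scale `r` with `b ≤ r < d`, identity maps
between these, and `0` elsewhere. -/
noncomputable def interval (F : Type*) [Field F] (b : ℝ) (d : WithTop ℝ) : PersistenceModule F where
  space r := intervalSpace F b d r
  map {r s} _ := (toIntervalSpace F b d s).comp (intervalSpace F b d r).subtype
  map_self r x := by
    obtain ⟨x, hx⟩ := x
    by_cases h : b ≤ r ∧ (r : WithTop ℝ) < d
    · ext; simp [toIntervalSpace, h]
    · simp only [intervalSpace, h, if_false, Submodule.mem_bot] at hx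
      subst hx
      ext; simp
  map_map {r s t} hrs hst x := by
    obtain ⟨x, hx⟩ := x
    by_cases h : b ≤ r ∧ (r : WithTop ℝ) < d
    · by_cases ht : b ≤ t ∧ (t : WithTop ℝ) < d
      · have hs : b ≤ s ∧ (s : WithTop ℝ) < d :=
          ⟨h.1.trans hrs, (WithTop.coe_le_coe.mpr hst).trans_lt ht.2⟩
        ext; simp [toIntervalSpace, hs, ht]
      · simp [toIntervalSpace, ht]
    · simp only [intervalSpace, h, if_false, Submodule.mem_bot] at hx
      subst hx
      ext; simp

/-- `D` is the persistence diagram of `V`: all its points `(b, d)` satisfy `b < d`, and `V` is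
isomorphic to the direct sum of the interval modules `[b, d)` over the points of the finite multiset
`D`. Bars that never die have `d = ⊤`. -/
def HasDiagram {F : Type*} [Field F] (V : PersistenceModule F) (D : Multiset (ℝ × WithTop ℝ)) :
    Prop :=
  ∃ (m : ℕ) (p : Fin m → ℝ × WithTop ℝ),
    D = (Finset.univ : Finset (Fin m)).val.map p ∧
    (∀ i, ((p i).1 : WithTop ℝ) < (p i).2) ∧
    Nonempty (Iso V (directSum fun i => interval F (p i).1 (p i).2))

end PersistenceModule

/-- The degree `k` Vietoris–Rips persistent homology of a metric space `Y`, with coefficients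
in `F`. -/
noncomputable def vrPersistentHomology (F : Type*) [Field F] (k : ℕ) (Y : Type*)
    [PseudoMetricSpace Y] : PersistenceModule F where
  space r := (vietorisRips Y r).Homology F k
  map h := PreAbstractSimplicialComplex.homologyMap F (vietorisRips_mono Y h) k
  map_self r x := by
    obtain ⟨x, rfl⟩ := Submodule.Quotient.mk_surjective _ x
    rfl
  map_map hrs hst x := by
    obtain ⟨x, rfl⟩ := Submodule.Quotient.mk_surjective _ x
    rfl

/-! ## Persistence sets -/

/-- The `(n, k)`-Vietoris–Rips persistence set of `X`: the degree `k` persistence diagrams of all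
subsets of `X` with at most `n` points, each with the metric induced from `X`. -/
def vrPersistenceSet (F : Type*) [Field F] (n k : ℕ) (X : Type*) [MetricSpace X] :
    Set (Multiset (ℝ × WithTop ℝ)) :=
  {D | ∃ Y : Finset X, Y.card ≤ n ∧ (vrPersistentHomology F k Y).HasDiagram D}

open Classical in
/-- The persistence diagram represented by a point `(b, d)` of the plane with `b ≤ d`: the one-point
diagram `{(b, d)}` if `b < d`, and the empty diagram if `(b, d)` is on the diagonal. -/
noncomputable def pointDiagram (b d : ℝ) : Multiset (ℝ × WithTop ℝ) :=
  if b < d then {(b, (d : WithTop ℝ))} else 0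

/-! A Vietoris–Rips complex is the clique complex of a graph. Such a complex is the union of the
star of a vertex `v`, which is a cone, and the deletion of `v`, glued along the link of `v`. If `w`
is a non-neighbour of `v`, the link misses both `v` and `w`, so passing to it lowers the degree by
one and the number of vertices by at least two. By induction, reduced homology in degree `k` needs
at least `2k + 2` vertices (`cycles_le_boundaries_of_ncard_lt`). With exactly `2k + 2` vertices it
forces every vertex to have a unique non-neighbour (`crossPolytope_of_not_mem_boundaries`); the
complex is then the boundary of a cross-polytope, and its homology in that degree is a line. The
induction is indexed by tuple length, one more than the degree, so that it can start at the empty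
tuple.

Hence, on at most `2k + 2` points, homology is nonzero only at scales where each point has a unique
opposite farther away than the scale. If such scales exist they form `[b, d)`, where `b` is the
largest distance between non-opposite points and `d` the smallest between opposite ones. The complex
is constant there, so the diagram is `{(b, d)}` (`vrPersistentHomology_isSpannedOn`,
`IsSpannedOn.eq_of_hasDiagram`); otherwise it is empty.

The rest is geometry of the circle. The bound `d ≤ π` is the diameter. For the lower bound put `ε =
π - b` and replace the opposite of each point by its antipode: this companion is closer than `ε` to
its own point and at least `ε` from every other. The arc from `v` to its opposite contains `k`
further points, and for odd `k` the companions force its length to be at least `(k + 1) ε`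
(`packing_bound`, `mul_pi_sub_le_dist_opposite`). Conversely, `k + 1` consecutive multiples of `ε`
and their antipodes, with one antipode moved to angle `d`, realize every point of the region
(`exists_hasDiagram_of_region`). -/

/-! ## Ordered chains of clique complexes -/

namespace CliqueChains

variable {V : Type*} (F : Type*) [Field F]

/-- The augmented simplicial boundary, from `(n+1)`-tuples to `n`-tuples. -/
noncomputable def bd (V : Type*) (n : ℕ) :
    ((Fin (n + 1) → V) →₀ F) →ₗ[F] ((Fin n → V) →₀ F) :=
  ∑ i : Fin (n + 1), (-1 : F) ^ (i : ℕ) •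
    Finsupp.lmapDomain F F (fun (v : Fin (n + 1) → V) (j : Fin n) => v (i.succAbove j))

/-- The cone operator, which prepends a vertex to every tuple. -/
noncomputable def cone (v : V) (n : ℕ) : ((Fin n → V) →₀ F) →ₗ[F] ((Fin (n + 1) → V) →₀ F) :=
  Finsupp.lmapDomain F F (fun t => Fin.cons v t)

variable {F}

theorem bd_single (n : ℕ) (t : Fin (n + 1) → V) (c : F) :
    bd F V n (Finsupp.single t c) =
      ∑ i : Fin (n + 1), (-1 : F) ^ (i : ℕ) • Finsupp.single (fun j => t (i.succAbove j)) c := by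
  simp [bd, LinearMap.sum_apply, Finsupp.mapDomain_single]

theorem cone_single (v : V) (n : ℕ) (t : Fin n → V) (c : F) :
    cone F v n (Finsupp.single t c) = Finsupp.single (Fin.cons v t) c := by
  simp [cone, Finsupp.mapDomain_single]

theorem bd_cone_zero (v : V) (z : (Fin 0 → V) →₀ F) : bd F V 0 (cone F v 0 z) = z := by
  induction z using Finsupp.induction_linear with
  | zero => simp
  | add f g hf hg => rw [map_add, map_add, hf, hg]
  | single t c =>
    rw [cone_single, bd_single]
    simp only [Fin.sum_univ_succ, Fin.val_zero, pow_zero, one_smul, Finset.univ_eq_empty,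
      Finset.sum_empty, add_zero]
    congr 1

/-- Deleting the apex returns the tuple; every other face is a cone over a face, with its sign
shifted by one. -/
theorem bd_cone_succ (v : V) (n : ℕ) (z : (Fin (n + 1) → V) →₀ F) :
    bd F V (n + 1) (cone F v (n + 1) z) = z - cone F v n (bd F V n z) := by
  induction z using Finsupp.induction_linear with
  | zero => simp
  | add f g hf hg => simp only [map_add, hf, hg]; abel
  | single t c =>
    rw [cone_single, bd_single, bd_single, Fin.sum_univ_succ, map_sum, sub_eq_add_neg,
      ← Finset.sum_neg_distrib]
    congr 1
    · simp
    · refine Finset.sum_congr rfl fun i _ => ?_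
      rw [map_smul, cone_single, Fin.val_succ, pow_succ, mul_neg_one, neg_smul]
      congr 3
      funext j
      refine Fin.cases ?_ (fun j => ?_) j
      · simp
      · simp [Fin.succ_succAbove_succ]

/-- Each tuple is the cone over its tail with its head as apex, so the cone formula and induction
replace the usual cancellation in a double sum. -/
theorem bd_bd (n : ℕ) (z : (Fin (n + 2) → V) →₀ F) : bd F V n (bd F V (n + 1) z) = 0 := by
  induction n with
  | zero =>
    induction z using Finsupp.induction_linear with
    | zero => simp
    | add f g hf hg => rw [map_add, map_add, hf, hg, add_zero]
    | single t c =>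
      rw [← Fin.cons_self_tail t, ← cone_single, bd_cone_succ, map_sub, bd_cone_zero, sub_self]
  | succ n ih =>
    induction z using Finsupp.induction_linear with
    | zero => simp
    | add f g hf hg => rw [map_add, map_add, hf, hg, add_zero]
    | single t c =>
      rw [← Fin.cons_self_tail t, ← cone_single, bd_cone_succ, map_sub, bd_cone_succ, ih, map_zero,
        sub_zero, sub_self]

/-! ### Chains, cycles and boundaries of a clique complex -/

variable (F) (R : V → V → Prop)

/-- The tuples of pairwise `R`-related elements of `S`. -/
def cliqueTuples (S : Set V) (n : ℕ) : Set (Fin n → V) :=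
  {t | (∀ i, t i ∈ S) ∧ ∀ i j, R (t i) (t j)}

/-- The ordered chains of the clique complex of `R` on `S`. -/
def chains (S : Set V) (n : ℕ) : Submodule F ((Fin n → V) →₀ F) :=
  Finsupp.supported F F (cliqueTuples R S n)

/-- The cycles of the augmented clique complex. -/
noncomputable def cycles (S : Set V) : (n : ℕ) → Submodule F ((Fin n → V) →₀ F)
  | 0 => chains F R S 0
  | n + 1 => chains F R S (n + 1) ⊓ LinearMap.ker (bd F V n)

/-- The boundaries of the clique complex. -/
noncomputable def boundaries (S : Set V) (n : ℕ) : Submodule F ((Fin n → V) →₀ F) :=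
  (chains F R S (n + 1)).map (bd F V n)

variable {F R} {S : Set V} {n : ℕ}

theorem single_mem_chains {t : Fin n → V} (ht : t ∈ cliqueTuples R S n) (c : F) :
    Finsupp.single t c ∈ chains F R S n :=
  Finsupp.single_mem_supported F c ht

theorem chains_le_iff {M : Submodule F ((Fin n → V) →₀ F)} :
    chains F R S n ≤ M ↔ ∀ t ∈ cliqueTuples R S n, Finsupp.single t 1 ∈ M := by
  rw [chains, Finsupp.supported_eq_span_single, Submodule.span_le]
  exact ⟨fun h t ht => h ⟨t, ht, rfl⟩, by rintro h _ ⟨t, ht, rfl⟩; exact h t ht⟩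

theorem chains_mono {S T : Set V} (h : S ⊆ T) (n : ℕ) : chains F R S n ≤ chains F R T n :=
  Finsupp.supported_mono fun _ ht => ⟨fun i => h (ht.1 i), ht.2⟩

theorem boundaries_mono {S T : Set V} (h : S ⊆ T) (n : ℕ) :
    boundaries F R S n ≤ boundaries F R T n :=
  Submodule.map_mono (chains_mono h _)

theorem cycles_le_chains : cycles F R S n ≤ chains F R S n := by
  cases n with
  | zero => exact le_rfl
  | succ n => exact inf_le_left

theorem bd_mem_chains {z : (Fin (n + 1) → V) →₀ F} (hz : z ∈ chains F R S (n + 1)) :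
    bd F V n z ∈ chains F R S n := by
  have : chains F R S (n + 1) ≤ (chains F R S n).comap (bd F V n) := by
    rw [chains_le_iff]
    intro t ht
    rw [Submodule.mem_comap, bd_single]
    exact Submodule.sum_mem _ fun i _ => Submodule.smul_mem _ _
      (single_mem_chains ⟨fun j => ht.1 _, fun _ _ => ht.2 _ _⟩ _)
  exact this hz

/-- The cone operator with apex `v` maps chains on common neighbours of `v` to chains. -/
theorem cone_mem_chains (hrefl : ∀ x, R x x) (hsymm : ∀ x y, R x y → R y x) {T : Set V} {v : V}
    (hv : v ∈ S) (hT : T ⊆ S) (hvT : ∀ w ∈ T, R v w) {z : (Fin n → V) →₀ F}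
    (hz : z ∈ chains F R T n) : cone F v n z ∈ chains F R S (n + 1) := by
  have : chains F R T n ≤ (chains F R S (n + 1)).comap (cone F v n) := by
    rw [chains_le_iff]
    intro t ht
    rw [Submodule.mem_comap, cone_single]
    refine single_mem_chains ⟨fun i => ?_, fun i j => ?_⟩ _
    · refine Fin.cases ?_ (fun i => ?_) i
      · simpa using hv
      · simpa using hT (ht.1 i)
    · refine Fin.cases ?_ (fun i => ?_) i <;> refine Fin.cases ?_ (fun j => ?_) j
      · simpa using hrefl v
      · simpa using hvT _ (ht.1 j)
      · simpa using hsymm _ _ (hvT _ (ht.1 i))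
      · simpa using ht.2 i j
  exact this hz

theorem bd_cone_of_mem_cycles {T : Set V} (v : V) {z : (Fin n → V) →₀ F}
    (hz : z ∈ cycles F R T n) : bd F V n (cone F v n z) = z := by
  cases n with
  | zero => exact bd_cone_zero v z
  | succ n =>
    have : bd F V n z = 0 := hz.2
    rw [bd_cone_succ, this, map_zero, sub_zero]

/-- Cones are acyclic. -/
theorem cycles_le_boundaries_of_cone (hrefl : ∀ x, R x x) (hsymm : ∀ x y, R x y → R y x) {v : V}
    (hv : v ∈ S) (hvS : ∀ w ∈ S, R v w) : cycles F R S n ≤ boundaries F R S n := fun z hz =>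
  ⟨cone F v n z, cone_mem_chains hrefl hsymm hv subset_rfl hvS (cycles_le_chains hz),
    bd_cone_of_mem_cycles v hz⟩

/-! ### Star, deletion and link: Mayer–Vietoris at the level of chains -/

/-- The link of `v` in `S`. -/
def link (R : V → V → Prop) (S : Set V) (v : V) : Set V := {w ∈ S | w ≠ v ∧ R v w}

/-- The closed neighbourhood of `v` in `S`. -/
def star (R : V → V → Prop) (S : Set V) (v : V) : Set V := {w ∈ S | R v w}

open Classical in
/-- The part of a chain made of the tuples that avoid `v`. -/
noncomputable def avoid (F : Type*) [Field F] (v : V) (n : ℕ) :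
    ((Fin n → V) →₀ F) →ₗ[F] ((Fin n → V) →₀ F) where
  toFun z := z.filter fun t => ∀ i, t i ≠ v
  map_add' _ _ := Finsupp.filter_add
  map_smul' _ _ := Finsupp.filter_smul

theorem avoid_mem {z : (Fin n → V) →₀ F} (hz : z ∈ chains F R S n) (v : V) :
    avoid F v n z ∈ chains F R (S \ {v}) n := by
  classical
  rw [chains, Finsupp.mem_supported] at hz ⊢
  intro t ht
  simp only [avoid, LinearMap.coe_mk, AddHom.coe_mk, Finsupp.support_filter, Finset.coe_filter,
    Set.mem_ofPred_eq] at ht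
  have h := hz ht.1
  exact ⟨fun i => ⟨h.1 i, ht.2 i⟩, h.2⟩

/-- What remains are the tuples through `v`; their entries are pairwise related, so all of them are
related to `v`. -/
theorem sub_avoid_mem {z : (Fin n → V) →₀ F} (hz : z ∈ chains F R S n) (v : V) :
    z - avoid F v n z ∈ chains F R (star R S v) n := by
  classical
  rw [chains, Finsupp.mem_supported] at hz ⊢
  intro t ht
  have ht' : ¬ ∀ i, t i ≠ v := by
    intro h
    simp [avoid, h] at ht
  have h : t ∈ cliqueTuples R S n := by
    apply hz
    simp only [avoid, LinearMap.coe_mk, AddHom.coe_mk, Finset.mem_coe, Finsupp.mem_support_iff,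
      Finsupp.sub_apply, Finsupp.filter_apply, if_neg ht', sub_zero] at ht ⊢
    exact ht
  push Not at ht'
  obtain ⟨i, rfl⟩ := ht'
  exact ⟨fun j => ⟨h.1 j, h.2 i j⟩, h.2⟩

theorem mem_chains_link {z : (Fin n → V) →₀ F} {v : V} (h₁ : z ∈ chains F R (S \ {v}) n)
    (h₂ : z ∈ chains F R (star R S v) n) : z ∈ chains F R (link R S v) n := by
  rw [chains, Finsupp.mem_supported] at *
  intro t ht
  exact ⟨fun i => ⟨((h₁ ht).1 i).1, ((h₁ ht).1 i).2, ((h₂ ht).1 i).2⟩, (h₁ ht).2⟩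

theorem link_subset (v : V) : link R S v ⊆ S := fun _ h => h.1

theorem star_subset (v : V) : star R S v ⊆ S := fun _ h => h.1

theorem link_subset_diff (v : V) : link R S v ⊆ S \ {v} := fun _ h => ⟨h.1, h.2.1⟩

theorem link_subset_star (v : V) : link R S v ⊆ star R S v := fun _ h => ⟨h.1, h.2.2⟩

/-- The connecting map of the Mayer–Vietoris sequence takes cycles to cycles of the link. -/
theorem bd_avoid_mem_cycles {z : (Fin (n + 1) → V) →₀ F} (hz : z ∈ cycles F R S (n + 1)) (v : V) :
    bd F V n (avoid F v (n + 1) z) ∈ cycles F R (link R S v) n := by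
  have hz0 : bd F V n z = 0 := hz.2
  have hmem : bd F V n (avoid F v (n + 1) z) ∈ chains F R (link R S v) n := by
    refine mem_chains_link (bd_mem_chains (avoid_mem hz.1 v)) ?_
    have h := Submodule.neg_mem _ (bd_mem_chains (sub_avoid_mem hz.1 v))
    rwa [map_sub, hz0, zero_sub, neg_neg] at h
  cases n with
  | zero => exact hmem
  | succ n => exact ⟨hmem, bd_bd _ _⟩

/-- Exactness in the Mayer–Vietoris sequence of the star of `v` and the deletion of `v`. -/
theorem mem_boundaries_of_link (hrefl : ∀ x, R x x) (hsymm : ∀ x y, R x y → R y x) {v : V}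
    (hv : v ∈ S) (hdel : cycles F R (S \ {v}) (n + 1) ≤ boundaries F R (S \ {v}) (n + 1))
    {z : (Fin (n + 1) → V) →₀ F} (hz : z ∈ cycles F R S (n + 1))
    (hlink : bd F V n (avoid F v (n + 1) z) ∈ boundaries F R (link R S v) n) :
    z ∈ boundaries F R S (n + 1) := by
  obtain ⟨u, hu, hbu⟩ := hlink
  have hz0 : bd F V n z = 0 := hz.2
  have h₁ : avoid F v (n + 1) z - u ∈ boundaries F R S (n + 1) := by
    refine boundaries_mono Set.sdiff_subset _ (hdel ⟨Submodule.sub_mem _ (avoid_mem hz.1 v)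
      (chains_mono (link_subset_diff v) _ hu), ?_⟩)
    rw [SetLike.mem_coe, LinearMap.mem_ker, map_sub, hbu, sub_self]
  have h₂ : z - avoid F v (n + 1) z + u ∈ boundaries F R S (n + 1) := by
    refine boundaries_mono (star_subset v) _ (cycles_le_boundaries_of_cone hrefl hsymm
      (S := star R S v) (v := v) ⟨hv, hrefl v⟩ (fun w hw => hw.2) ⟨Submodule.add_mem _ (sub_avoid_mem hz.1 v)
      (chains_mono (link_subset_star v) _ hu), ?_⟩)
    rw [SetLike.mem_coe, LinearMap.mem_ker, map_add, map_sub, hbu, hz0, zero_sub, neg_add_cancel]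
  have := Submodule.add_mem _ h₁ h₂
  rwa [show avoid F v (n + 1) z - u + (z - avoid F v (n + 1) z + u) = z by abel] at this

/-! ### Vertex counts and cross-polytopes -/

theorem ncard_link_add_two_le [Finite V] (hrefl : ∀ x, R x x) {v w : V} (hv : v ∈ S) (hw : w ∈ S)
    (hvw : ¬ R v w) : (link R S v).ncard + 2 ≤ S.ncard := by
  have hne : v ≠ w := by rintro rfl; exact hvw (hrefl v)
  have h : Disjoint (link R S v) {v, w} := by
    rw [Set.disjoint_left]
    rintro x hx (rfl | rfl)
    · exact hx.2.1 rfl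
    · exact hvw hx.2.2
  rw [← Set.ncard_pair hne, ← Set.ncard_union_eq h]
  refine Set.ncard_le_ncard (Set.union_subset (link_subset v) ?_)
  rintro x (rfl | rfl) <;> assumption

/-- The clique complex on fewer than `2 n` vertices has no reduced homology in degree `n - 1`. -/
theorem cycles_le_boundaries_of_ncard_lt [Finite V] (hrefl : ∀ x, R x x)
    (hsymm : ∀ x y, R x y → R y x) (m : ℕ) :
    ∀ (S : Set V) (n : ℕ), S.ncard = m → m < 2 * n → cycles F R S n ≤ boundaries F R S n := by
  induction m using Nat.strong_induction_on with
  | _ m ih =>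
  intro S n hS hm z hz
  obtain ⟨n, rfl⟩ : ∃ j, n = j + 1 := ⟨n - 1, by omega⟩
  rcases S.eq_empty_or_nonempty with rfl | ⟨v, hv⟩
  · have : z = 0 := by
      have h := cycles_le_chains hz
      rw [chains, Finsupp.mem_supported] at h
      rw [← Finsupp.support_eq_empty, Finset.eq_empty_iff_forall_notMem]
      exact fun t ht => (h ht).1 0
    rw [this]
    exact Submodule.zero_mem _
  · by_cases hdom : ∀ w ∈ S, R v w
    · exact cycles_le_boundaries_of_cone hrefl hsymm hv hdom hz
    · push Not at hdom
      obtain ⟨w, hw, hvw⟩ := hdom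
      -- The link loses two vertices while the tuple length drops by one, so the strict inequality
      -- `m < 2 * n` is inherited by the link; the deletion keeps the length and has fewer vertices.
      have hcard := ncard_link_add_two_le hrefl hv hw hvw
      have hdel := Set.ncard_sdiff_singleton_add_one hv
      refine mem_boundaries_of_link hrefl hsymm hv
        (ih (m - 1) (by omega) _ _ (by omega) (by omega)) hz ?_
      exact ih _ (by omega) _ _ rfl (by omega) (bd_avoid_mem_cycles hz v)

/-- A clique complex on at most `2 n` vertices with reduced homology in degree `n - 1` is the
boundary of a cross-polytope. -/
theorem crossPolytope_of_not_mem_boundaries [Finite V] (hrefl : ∀ x, R x x)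
    (hsymm : ∀ x y, R x y → R y x) (hS : S.ncard ≤ 2 * n) {z : (Fin n → V) →₀ F}
    (hz : z ∈ cycles F R S n) (hzb : z ∉ boundaries F R S n) :
    S.ncard = 2 * n ∧ ∀ v ∈ S, ∃! w, w ∈ S ∧ ¬ R v w := by
  have hcard : S.ncard = 2 * n := by
    by_contra h
    exact hzb (cycles_le_boundaries_of_ncard_lt hrefl hsymm _ S n rfl (by omega) hz)
  refine ⟨hcard, fun v hv => ?_⟩
  obtain ⟨w, hw, hvw⟩ : ∃ w ∈ S, ¬ R v w := by
    by_contra! h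
    exact hzb (cycles_le_boundaries_of_cone hrefl hsymm hv h hz)
  refine ⟨w, ⟨hw, hvw⟩, ?_⟩
  rintro x ⟨hx, hvx⟩
  by_contra hxw
  have hpos : 0 < S.ncard := (Set.ncard_pos).2 ⟨v, hv⟩
  obtain ⟨n, rfl⟩ : ∃ j, n = j + 1 := ⟨n - 1, by omega⟩
  have hdel := Set.ncard_sdiff_singleton_add_one hv
  -- A second non-neighbour `x` is also absent from the link. Counting in `S \ {x}` then makes the
  -- link small enough to be acyclic in the relevant degree.
  have hlt : (link R S v).ncard + 2 < S.ncard := by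
    have h := ncard_link_add_two_le (S := S \ {x}) hrefl (v := v) (w := w)
      ⟨hv, by rintro rfl; exact hvx (hrefl _)⟩ ⟨hw, Ne.symm hxw⟩ hvw
    have hl : link R (S \ {x}) v = link R S v := by
      ext y
      constructor
      · rintro ⟨hy, hvy⟩
        exact ⟨hy.1, hvy⟩
      · rintro ⟨hy, hvy⟩
        exact ⟨⟨hy, by rintro rfl; exact hvx hvy.2⟩, hvy⟩
    have hx' := Set.ncard_sdiff_singleton_add_one hx
    rw [hl] at h
    omega
  exact hzb (mem_boundaries_of_link hrefl hsymm hv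
    (cycles_le_boundaries_of_ncard_lt hrefl hsymm _ _ _ rfl (by omega)) hz
    (cycles_le_boundaries_of_ncard_lt hrefl hsymm _ _ _ rfl (by omega)
      (bd_avoid_mem_cycles hz v)))

/-- The reduced homology in degree `n - 1` of a clique complex on at most `2 n` vertices is at most
one-dimensional. -/
theorem exists_smul_add_smul_mem_boundaries [Finite V] (hrefl : ∀ x, R x x)
    (hsymm : ∀ x y, R x y → R y x) (n : ℕ) :
    ∀ (S : Set V), S.ncard ≤ 2 * n → ∀ z ∈ cycles F R S n, ∀ z' ∈ cycles F R S n,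
      ∃ a b : F, (a ≠ 0 ∨ b ≠ 0) ∧ a • z + b • z' ∈ boundaries F R S n := by
  induction n with
  | zero =>
    intro S _ z _ z' _
    -- There is only one empty tuple, so chains of length zero form a line and two of them are
    -- proportional.
    by_cases h : z Fin.elim0 = 0
    · refine ⟨1, 0, Or.inl one_ne_zero, ?_⟩
      have : z = 0 := Finsupp.ext fun t => by rwa [Subsingleton.elim t Fin.elim0]
      simp [this]
    · refine ⟨z' Fin.elim0, - z Fin.elim0, Or.inr (neg_ne_zero.2 h), ?_⟩
      convert Submodule.zero_mem _ using 1
      refine Finsupp.ext fun t => ?_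
      rw [Subsingleton.elim t Fin.elim0]
      simp [mul_comm]
  | succ n ih =>
    intro S hS z hz z' hz'
    by_cases hzb : z ∈ boundaries F R S (n + 1)
    · exact ⟨1, 0, Or.inl one_ne_zero, by simpa using hzb⟩
    obtain ⟨hcard, hmatch⟩ := crossPolytope_of_not_mem_boundaries hrefl hsymm hS hz hzb
    obtain ⟨v, hv⟩ := (Set.ncard_pos).1 (show 0 < S.ncard by omega)
    obtain ⟨w, ⟨hw, hvw⟩, -⟩ := hmatch v hv
    have h2 := ncard_link_add_two_le hrefl hv hw hvw
    have hdel := Set.ncard_sdiff_singleton_add_one hv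
    obtain ⟨a, b, hab, h⟩ := ih (link R S v) (by omega) _ (bd_avoid_mem_cycles hz v) _
      (bd_avoid_mem_cycles hz' v)
    refine ⟨a, b, hab, mem_boundaries_of_link hrefl hsymm hv
      (cycles_le_boundaries_of_ncard_lt hrefl hsymm _ _ _ rfl (by omega))
      (Submodule.add_mem _ (Submodule.smul_mem _ _ hz) (Submodule.smul_mem _ _ hz')) ?_⟩
    simpa only [map_add, map_smul] using h

/-- The boundary of a cross-polytope carries a cycle that does not bound. -/
theorem exists_cycle_of_crossPolytope [Finite V] (hrefl : ∀ x, R x x)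
    (hsymm : ∀ x y, R x y → R y x) (n : ℕ) :
    ∀ S : Set V, S.ncard = 2 * n → (∀ v ∈ S, ∃! w, w ∈ S ∧ ¬ R v w) →
      ∃ z ∈ cycles F R S n, z ∉ boundaries F R S n := by
  induction n with
  | zero =>
    intro S hS _
    have hS : S = ∅ := (Set.ncard_eq_zero).1 hS
    subst hS
    -- The empty complex has reduced homology in degree `-1`, generated by the empty tuple.
    refine ⟨Finsupp.single Fin.elim0 1, single_mem_chains ⟨fun i => i.elim0, fun i => i.elim0⟩ _, ?_⟩
    rintro ⟨u, hu, h⟩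
    have : u = 0 := by
      rw [SetLike.mem_coe, chains, Finsupp.mem_supported] at hu
      rw [← Finsupp.support_eq_empty, Finset.eq_empty_iff_forall_notMem]
      exact fun t ht => (hu ht).1 0
    rw [this, map_zero] at h
    exact one_ne_zero (Finsupp.single_eq_zero.1 h.symm)
  | succ n ih =>
    intro S hS hmatch
    obtain ⟨v, hv⟩ := (Set.ncard_pos).1 (show 0 < S.ncard by omega)
    obtain ⟨w, ⟨hw, hvw⟩, huniq⟩ := hmatch v hv
    have hne : v ≠ w := by rintro rfl; exact hvw (hrefl v)
    have hlink : link R S v = S \ {v, w} := by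
      ext x
      simp only [link, Set.mem_ofPred_eq, Set.mem_sdiff, Set.mem_insert_iff, Set.mem_singleton_iff,
        not_or]
      refine and_congr_right fun hx => and_congr_right fun _ => ⟨?_, fun h => ?_⟩
      · rintro h rfl
        exact hvw h
      · by_contra h'
        exact h (huniq x ⟨hx, h'⟩)
    have hwlink : ∀ x ∈ link R S v, R w x := by
      intro x hx
      by_contra h
      obtain ⟨y, -, hy⟩ := hmatch w hw
      have h1 := hy x ⟨hx.1, h⟩
      have h2 := hy v ⟨hv, fun h => hvw (hsymm _ _ h)⟩
      exact hx.2.1 (h1.trans h2.symm)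
    have hcard : (link R S v).ncard = 2 * n := by
      have h : ({v, w} : Set V) ⊆ S := by rintro x (rfl | rfl) <;> assumption
      have h' := Set.ncard_sdiff_add_ncard_of_subset h
      rw [Set.ncard_pair hne] at h'
      rw [hlink]
      omega
    obtain ⟨z, hz, hzb⟩ := ih (link R S v) hcard (by
      intro x hx
      obtain ⟨y, ⟨hy, hxy⟩, huy⟩ := hmatch x hx.1
      refine ⟨y, ⟨?_, hxy⟩, fun y' hy' => huy y' ⟨hy'.1.1, hy'.2⟩⟩
      rw [hlink]
      refine ⟨hy, ?_⟩
      rintro (rfl | rfl)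
      · exact hxy (hsymm _ _ hx.2.2)
      · exact hxy (hsymm _ _ (hwlink x hx)))
    have hzc := cycles_le_chains hz
    have hvz : cone F v n z ∈ chains F R (star R S v) (n + 1) :=
      cone_mem_chains (S := star R S v) hrefl hsymm ⟨hv, hrefl v⟩ (link_subset_star v) (fun x hx => hx.2.2) hzc
    have hwz : cone F w n z ∈ chains F R (S \ {v}) (n + 1) :=
      cone_mem_chains (S := S \ {v}) hrefl hsymm ⟨hw, hne.symm⟩ (link_subset_diff v) hwlink hzc
    -- The suspension of the link cycle `z`, with the opposite vertices `v` and `w` as poles.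
    refine ⟨cone F v n z - cone F w n z, ⟨Submodule.sub_mem _
      (chains_mono (star_subset v) _ hvz) (chains_mono Set.sdiff_subset _ hwz), ?_⟩, ?_⟩
    · rw [SetLike.mem_coe, LinearMap.mem_ker, map_sub, bd_cone_of_mem_cycles v hz, bd_cone_of_mem_cycles w hz,
        sub_self]
    · rintro ⟨u, hu, hbu⟩
      -- If `u` bounds the suspension, split it into its tuples avoiding `v` and the others. The
      -- left side avoids `v` and the right side lies in the star, so the common chain lies in the
      -- link; its boundary is `z`, which does not bound there.
      have heq : bd F V (n + 1) (avoid F v (n + 2) u) + cone F w n z =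
          cone F v n z - bd F V (n + 1) (u - avoid F v (n + 2) u) := by
        rw [map_sub, hbu]
        abel
      have h₁ : bd F V (n + 1) (avoid F v (n + 2) u) + cone F w n z ∈
          chains F R (S \ {v}) (n + 1) :=
        Submodule.add_mem _ (bd_mem_chains (avoid_mem hu v)) hwz
      have h₂ : bd F V (n + 1) (avoid F v (n + 2) u) + cone F w n z ∈
          chains F R (star R S v) (n + 1) := by
        rw [heq]
        exact Submodule.sub_mem _ hvz (bd_mem_chains (sub_avoid_mem hu v))
      refine hzb ⟨_, mem_chains_link h₁ h₂, ?_⟩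
      rw [map_add, bd_bd, zero_add, bd_cone_of_mem_cycles w hz]

end CliqueChains

/-! ## Persistence diagrams of thin modules -/

namespace PersistenceModule

universe u v

variable {F : Type u} [Field F]

/-- A persistence module is spanned on `[b, d)` by a compatible family of nonzero vectors, and is
zero elsewhere. -/
structure IsSpannedOn (V : PersistenceModule.{u, v} F) (b d : ℝ) (g : ∀ r, V.space r) : Prop where
  lt : b < d
  ne_zero : ∀ r, b ≤ r → r < d → g r ≠ 0
  exists_smul : ∀ r, b ≤ r → r < d → ∀ x, ∃ c : F, c • g r = x
  map_eq : ∀ {r s} (h : r ≤ s), b ≤ r → s < d → V.map h (g r) = g s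
  eq_zero : ∀ r, ¬(b ≤ r ∧ r < d) → ∀ x : V.space r, x = 0

theorem mem_intervalSpace {b : ℝ} {d : WithTop ℝ} {r : ℝ} (h : b ≤ r ∧ (r : WithTop ℝ) < d)
    (x : F) : x ∈ intervalSpace F b d r := by
  simp [intervalSpace, h]

theorem intervalSpace_support {b : ℝ} {d : WithTop ℝ} {r : ℝ} (x : intervalSpace F b d r)
    (hx : (x : F) ≠ 0) : b ≤ r ∧ (r : WithTop ℝ) < d := by
  obtain ⟨x, h⟩ := x
  by_contra hr
  simp only [intervalSpace, hr, if_false, Submodule.mem_bot] at h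
  exact hx h

open Classical in
theorem toIntervalSpace_coe (b : ℝ) (d : WithTop ℝ) (r : ℝ) (x : F) :
    (toIntervalSpace F b d r x : F) = if b ≤ r ∧ (r : WithTop ℝ) < d then x else 0 := by
  unfold toIntervalSpace
  split_ifs <;> simp

section DirectSum

variable {m : ℕ} (p : Fin m → ℝ × WithTop ℝ)

/-- The `i`-th coordinate on a direct sum of interval modules. -/
noncomputable def coord (i : Fin m) (r : ℝ) :
    (directSum fun i => interval F (p i).1 (p i).2).space r →ₗ[F] F :=
  (intervalSpace F (p i).1 (p i).2 r).subtype.comp (LinearMap.proj i)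

theorem ext_coord {r : ℝ} {x y : (directSum fun i => interval F (p i).1 (p i).2).space r}
    (h : ∀ i, coord p i r x = coord p i r y) : x = y :=
  funext fun i => Subtype.ext (h i)

/-- The vector of a direct sum of interval modules with given coordinates. -/
noncomputable def ofCoord {r : ℝ} (c : Fin m → F) (hc : ∀ i, c i ∈ intervalSpace F (p i).1 (p i).2 r) :
    (directSum fun i => interval F (p i).1 (p i).2).space r :=
  fun i => (⟨c i, hc i⟩ : intervalSpace F (p i).1 (p i).2 r)

theorem coord_ofCoord {r : ℝ} (c : Fin m → F)
    (hc : ∀ i, c i ∈ intervalSpace F (p i).1 (p i).2 r) (i : Fin m) :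
    coord p i r (ofCoord p c hc) = c i :=
  rfl

/-- The generator of the `i`-th summand of a direct sum of interval modules. -/
noncomputable def basisVector (i : Fin m) (r : ℝ)
    (hr : (p i).1 ≤ r ∧ (r : WithTop ℝ) < (p i).2) :
    (directSum fun i => interval F (p i).1 (p i).2).space r :=
  ofCoord p (Pi.single i 1) fun j => by
    by_cases h : j = i
    · subst h
      exact mem_intervalSpace hr _
    · rw [Pi.single_eq_of_ne h]
      exact Submodule.zero_mem _

theorem coord_basisVector_self (i : Fin m) (r : ℝ)
    (hr : (p i).1 ≤ r ∧ (r : WithTop ℝ) < (p i).2) :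
    coord p i r (basisVector (F := F) p i r hr) = 1 := by
  rw [basisVector, coord_ofCoord, Pi.single_eq_same]

theorem coord_basisVector_of_ne {i j : Fin m} (hij : j ≠ i) (r : ℝ)
    (hr : (p i).1 ≤ r ∧ (r : WithTop ℝ) < (p i).2) :
    coord p j r (basisVector (F := F) p i r hr) = 0 := by
  rw [basisVector, coord_ofCoord, Pi.single_eq_of_ne hij]

theorem basisVector_ne_zero (i : Fin m) (r : ℝ)
    (hr : (p i).1 ≤ r ∧ (r : WithTop ℝ) < (p i).2) : basisVector (F := F) p i r hr ≠ 0 := by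
  intro h
  have h1 := coord_basisVector_self (F := F) p i r hr
  rw [h, map_zero] at h1
  exact zero_ne_one h1

theorem coord_support (i : Fin m) {r : ℝ}
    (x : (directSum fun i => interval F (p i).1 (p i).2).space r) (hx : coord p i r x ≠ 0) :
    (p i).1 ≤ r ∧ (r : WithTop ℝ) < (p i).2 :=
  intervalSpace_support (b := (p i).1) (d := (p i).2) (x i) hx

open Classical in
theorem coord_map (i : Fin m) {r s : ℝ} (h : r ≤ s)
    (x : (directSum fun i => interval F (p i).1 (p i).2).space r) :
    coord p i s ((directSum fun i => interval F (p i).1 (p i).2).map h x) =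
      if (p i).1 ≤ s ∧ (s : WithTop ℝ) < (p i).2 then coord p i r x else 0 :=
  toIntervalSpace_coe _ _ _ _

theorem coord_map_ne_zero (i : Fin m) {r s : ℝ} (h : r ≤ s)
    (x : (directSum fun i => interval F (p i).1 (p i).2).space r)
    (hx : coord p i s ((directSum fun i => interval F (p i).1 (p i).2).map h x) ≠ 0) :
    coord p i r x ≠ 0 := by
  rw [coord_map] at hx
  exact fun h0 => hx (by simp [h0])

end DirectSum

/-- Scaling the generator `g r` by the single coordinate is the isomorphism from the interval
module. -/
theorem IsSpannedOn.hasDiagram {V : PersistenceModule.{u, v} F} {b d : ℝ} {g : ∀ r, V.space r}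
    (h : V.IsSpannedOn b d g) : V.HasDiagram {(b, (d : WithTop ℝ))} := by
  let p : Fin 1 → ℝ × WithTop ℝ := fun _ => (b, (d : WithTop ℝ))
  let f : ∀ r, (directSum fun i => interval F (p i).1 (p i).2).space r →ₗ[F] V.space r :=
    fun r => (LinearMap.toSpanSingleton F _ (g r)).comp (coord p 0 r)
  have hf : ∀ r y, f r y = coord p 0 r y • g r := fun r y => rfl
  have hbij : ∀ r, Function.Bijective (f r) := by
    intro r
    constructor
    · rw [injective_iff_map_eq_zero]
      intro y hy
      rw [hf] at hy
      refine ext_coord p fun i => ?_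
      rw [Subsingleton.elim i 0, map_zero]
      by_contra hne
      have hr := coord_support p 0 y hne
      rcases smul_eq_zero.1 hy with h0 | h0
      · exact hne h0
      · exact h.ne_zero r hr.1 (WithTop.coe_lt_coe.1 hr.2) h0
    · intro x
      by_cases hr : b ≤ r ∧ r < d
      · obtain ⟨c, rfl⟩ := h.exists_smul r hr.1 hr.2 x
        exact ⟨ofCoord p (fun _ => c) fun _ =>
          mem_intervalSpace ⟨hr.1, WithTop.coe_lt_coe.2 hr.2⟩ c, rfl⟩
      · exact ⟨0, by rw [map_zero, h.eq_zero r hr x]⟩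
  refine ⟨1, p, by simp [p], fun _ => WithTop.coe_lt_coe.2 h.lt,
    ⟨⟨fun r => (LinearEquiv.ofBijective (f r) (hbij r)).symm, ?_⟩⟩⟩
  intro r s hrs x
  obtain ⟨y, rfl⟩ := (LinearEquiv.ofBijective (f r) (hbij r)).surjective x
  rw [LinearEquiv.symm_apply_eq, LinearEquiv.symm_apply_apply, LinearEquiv.ofBijective_apply,
    LinearEquiv.ofBijective_apply, hf, hf, map_smul, coord_map]
  by_cases hs : b ≤ s ∧ s < d
  · rw [if_pos ⟨hs.1, WithTop.coe_lt_coe.2 hs.2⟩]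
    by_cases hr : b ≤ r
    · rw [h.map_eq hrs hr hs.2]
    · have h0 : coord p 0 r y = 0 := by
        by_contra hne
        exact hr (coord_support p 0 y hne).1
      rw [h0, zero_smul, zero_smul]
  · rw [h.eq_zero s hs (_ • g s)]
    exact h.eq_zero s hs _

theorem hasDiagram_zero {V : PersistenceModule.{u, v} F} (h : ∀ r (x : V.space r), x = 0) :
    V.HasDiagram 0 := by
  refine ⟨0, Fin.elim0, by simp, fun i => i.elim0, ⟨⟨fun r => ?_, ?_⟩⟩⟩
  · exact
      { toFun := fun _ i => i.elim0
        invFun := fun _ => 0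
        map_add' := fun _ _ => funext fun i => i.elim0
        map_smul' := fun _ _ => funext fun i => i.elim0
        left_inv := fun x => (h r x).symm
        right_inv := fun _ => funext fun i => i.elim0 }
  · exact fun _ _ => funext fun i => i.elim0

theorem HasDiagram.eq_zero {V : PersistenceModule.{u, v} F} {D : Multiset (ℝ × WithTop ℝ)}
    (hD : V.HasDiagram D) (h : ∀ r (x : V.space r), x = 0) : D = 0 := by
  obtain ⟨m, p, rfl, hp, ⟨e⟩⟩ := hD
  rcases m with - | m
  · simp
  · exfalso
    refine basisVector_ne_zero (F := F) p 0 (p 0).1 ⟨le_rfl, hp 0⟩ ?_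
    rw [← (e.equiv _).apply_symm_apply (basisVector p 0 (p 0).1 ⟨le_rfl, hp 0⟩),
      h _ ((e.equiv _).symm _), map_zero]

/-- Uniqueness of the decomposition needs no general theorem here: isomorphisms between nonzero
lines on `[b, d)` force each summand to live on all of `[b, d)`, and one-dimensionality leaves room
for just one. -/
theorem IsSpannedOn.eq_of_hasDiagram {V : PersistenceModule.{u, v} F} {b d : ℝ}
    {g : ∀ r, V.space r} (h : V.IsSpannedOn b d g) {D : Multiset (ℝ × WithTop ℝ)}
    (hD : V.HasDiagram D) : D = {(b, (d : WithTop ℝ))} := by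
  obtain ⟨m, p, rfl, hp, ⟨e⟩⟩ := hD
  let W : PersistenceModule F := directSum fun i => interval F (p i).1 (p i).2
  have hne : ∀ r i hr, basisVector (F := F) p i r hr ≠ 0 :=
    fun r i hr => basisVector_ne_zero p i r hr
  have hsub : ∀ i r, ((p i).1 ≤ r ∧ (r : WithTop ℝ) < (p i).2) → b ≤ r ∧ r < d := by
    intro i r hr
    by_contra hn
    refine hne r i hr ?_
    rw [← (e.equiv r).apply_symm_apply (basisVector p i r hr), h.eq_zero r hn ((e.equiv r).symm _),
      map_zero]
  -- The generator of the summand at `s` is the image of a vector at `r`, whose `i`-th coordinate is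
  -- therefore nonzero.
  have hdown : ∀ i r s, r ≤ s → b ≤ r → ((p i).1 ≤ s ∧ (s : WithTop ℝ) < (p i).2) →
      ((p i).1 ≤ r ∧ (r : WithTop ℝ) < (p i).2) := by
    intro i r s hrs hbr hs
    obtain ⟨c, hc⟩ := h.exists_smul s (hsub i s hs).1 (hsub i s hs).2
      ((e.equiv s).symm (basisVector p i s hs))
    rw [LinearEquiv.eq_symm_apply, ← h.map_eq hrs hbr (hsub i s hs).2, ← map_smul, e.comm] at hc
    refine coord_support p i _ (coord_map_ne_zero p i hrs (e.equiv r (c • g r)) ?_)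
    rw [hc, coord_basisVector_self]
    exact one_ne_zero
  -- The map from `r` to `s` is injective, so the generator survives; since structure maps are
  -- diagonal, it survives in coordinate `i`.
  have hup : ∀ i r s, r ≤ s → s < d → ((p i).1 ≤ r ∧ (r : WithTop ℝ) < (p i).2) →
      ((p i).1 ≤ s ∧ (s : WithTop ℝ) < (p i).2) := by
    intro i r s hrs hsd hr
    have hbr := (hsub i r hr).1
    obtain ⟨c, hc⟩ := h.exists_smul r hbr (hsub i r hr).2
      ((e.equiv r).symm (basisVector p i r hr))
    have hc0 : c ≠ 0 := by
      rintro rfl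
      rw [zero_smul, eq_comm, LinearEquiv.symm_apply_eq, map_zero] at hc
      exact hne r i hr hc
    have hmap : W.map hrs (basisVector p i r hr) ≠ 0 := by
      rw [LinearEquiv.eq_symm_apply] at hc
      rw [← hc, ← e.comm, map_smul, h.map_eq hrs hbr hsd]
      intro h0
      rw [LinearEquiv.map_eq_zero_iff] at h0
      exact (smul_ne_zero hc0 (h.ne_zero s (hbr.trans hrs) hsd)) h0
    obtain ⟨j, hj⟩ : ∃ j, coord p j s (W.map hrs (basisVector p i r hr)) ≠ 0 := by
      by_contra! hall
      exact hmap (ext_coord p fun j => (hall j).trans (map_zero _).symm)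
    have hj' := coord_map_ne_zero p j hrs _ hj
    have hji : j = i := by
      by_contra hji
      exact hj' (coord_basisVector_of_ne p hji r hr)
    rw [← hji]
    exact coord_support p j _ hj
  have hiff : ∀ i r, ((p i).1 ≤ r ∧ (r : WithTop ℝ) < (p i).2) ↔ b ≤ r ∧ r < d := by
    refine fun i r => ⟨hsub i r, fun hr => ?_⟩
    rcases le_total r (p i).1 with hle | hle
    · exact hdown i r _ hle hr.1 ⟨le_rfl, hp i⟩
    · exact hup i _ r hle hr.2 ⟨le_rfl, hp i⟩
  have hb : ∀ i, (p i).1 ≤ b ∧ (b : WithTop ℝ) < (p i).2 := fun i =>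
    (hiff i b).2 ⟨le_rfl, h.lt⟩
  -- At scale `b` the space is a line, so the generators of two different summands would be
  -- proportional.
  have hsubs : ∀ i j : Fin m, i = j := by
    intro i j
    by_contra hij
    obtain ⟨c, hc⟩ := h.exists_smul b le_rfl h.lt ((e.equiv b).symm (basisVector p i b (hb i)))
    obtain ⟨c', hc'⟩ := h.exists_smul b le_rfl h.lt ((e.equiv b).symm (basisVector p j b (hb j)))
    rw [LinearEquiv.eq_symm_apply, map_smul] at hc hc'
    have hrel : c' • basisVector (F := F) p i b (hb i) = c • basisVector p j b (hb j) := by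
      rw [← hc, ← hc', smul_comm]
    have h1 := congrArg (coord (F := F) p i b) hrel
    rw [map_smul, map_smul, coord_basisVector_self, coord_basisVector_of_ne p hij, smul_eq_mul,
      mul_one, smul_zero] at h1
    rw [h1, zero_smul] at hc'
    exact hne b j (hb j) hc'.symm
  have hm : m ≠ 0 := by
    rintro rfl
    apply h.ne_zero b le_rfl h.lt
    rw [← (e.equiv b).map_eq_zero_iff]
    exact funext fun i => i.elim0
  obtain ⟨m, rfl⟩ := Nat.exists_eq_succ_of_ne_zero hm
  have hm1 : m = 0 := by
    by_contra hm0
    have := hsubs 0 ⟨1, by omega⟩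
    simp [Fin.ext_iff] at this
  subst hm1
  have h1 : (p 0).1 = b := le_antisymm (hb 0).1 ((hiff 0 _).1 ⟨le_rfl, hp 0⟩).1
  have h2 : (p 0).2 = (d : WithTop ℝ) := by
    refine le_antisymm ?_ ?_
    · by_contra! hlt
      have := ((hiff 0 d).1 ⟨h1.le.trans h.lt.le, hlt⟩).2
      exact lt_irrefl _ this
    · by_contra! hlt
      obtain ⟨d', hd'⟩ := WithTop.ne_top_iff_exists.1 hlt.ne_top
      rw [← hd'] at hlt
      have hb0 := (hb 0).2
      rw [← hd'] at hb0
      have := ((hiff 0 d').2 ⟨(WithTop.coe_lt_coe.1 hb0).le, WithTop.coe_lt_coe.1 hlt⟩).2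
      rw [← hd'] at this
      exact lt_irrefl _ this
  simp [← h1, ← h2]

end PersistenceModule

/-! ### Homology classes represented by chains -/

namespace PreAbstractSimplicialComplex

variable {F : Type*} [Field F] {V : Type*} {K L : PreAbstractSimplicialComplex V} {n : ℕ}

open Classical in
/-- The homology class of a chain, with junk value zero unless the chain is a cycle. -/
noncomputable def homologyClass (K : PreAbstractSimplicialComplex V) (n : ℕ)
    (z : (Fin (n + 1) → V) →₀ F) : K.Homology F n :=
  if h : z ∈ K.cycles F n then Submodule.Quotient.mk ⟨z, h⟩ else 0

theorem exists_homologyClass_eq (x : K.Homology F n) :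
    ∃ z ∈ K.cycles F n, homologyClass K n z = x := by
  obtain ⟨⟨z, hz⟩, rfl⟩ := Submodule.Quotient.mk_surjective _ x
  exact ⟨z, hz, dif_pos hz⟩

theorem homologyClass_eq_zero_iff {z : (Fin (n + 1) → V) →₀ F} (hz : z ∈ K.cycles F n) :
    homologyClass K n z = 0 ↔ z ∈ K.boundaries F n := by
  rw [homologyClass, dif_pos hz]
  exact Submodule.Quotient.mk_eq_zero _

theorem smul_homologyClass_eq {z y : (Fin (n + 1) → V) →₀ F} (hz : z ∈ K.cycles F n)
    (hy : y ∈ K.cycles F n) {c : F} (h : c • z - y ∈ K.boundaries F n) :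
    c • homologyClass K n z = homologyClass K n y := by
  rw [homologyClass, homologyClass, dif_pos hz, dif_pos hy]
  exact (Submodule.Quotient.eq _).2 h

theorem homologyMap_homologyClass (h : K ≤ L) {z : (Fin (n + 1) → V) →₀ F}
    (hz : z ∈ K.cycles F n) :
    homologyMap F h n (homologyClass K n z) = homologyClass L n z := by
  rw [homologyClass, homologyClass, dif_pos hz, dif_pos (cycles_mono F h n hz)]
  rfl

end PreAbstractSimplicialComplex

/-! ## Vietoris–Rips complexes as clique complexes -/

section VietorisRips

variable (F : Type*) [Field F] {Y : Type*} [PseudoMetricSpace Y]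

theorem vietorisRips_chains (r : ℝ) (n : ℕ) :
    (vietorisRips Y r).chains F n =
      CliqueChains.chains F (fun x y : Y => dist x y ≤ r) Set.univ (n + 1) := by
  classical
  unfold PreAbstractSimplicialComplex.chains CliqueChains.chains
  congr 1
  ext t
  constructor
  · rintro ⟨σ, hσ, ht⟩
    exact ⟨fun _ => trivial, fun i j =>
      (Metric.dist_le_diam_of_mem σ.finite_toSet.isBounded (ht i) (ht j)).trans hσ.2⟩
  · rintro ⟨-, ht⟩
    refine ⟨Finset.univ.image t, ⟨⟨t 0, by simp⟩, ?_⟩, fun i => by simp⟩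
    refine Metric.diam_le_of_forall_dist_le (dist_nonneg.trans (ht 0 0)) ?_
    simpa using ht

theorem vietorisRips_boundaries (r : ℝ) (n : ℕ) :
    (vietorisRips Y r).boundaries F n =
      CliqueChains.boundaries F (fun x y : Y => dist x y ≤ r) Set.univ (n + 1) := by
  unfold PreAbstractSimplicialComplex.boundaries CliqueChains.boundaries
  rw [vietorisRips_chains]
  rfl

/-- Degree zero is excluded because there every chain is a cycle, whereas the augmented complex also
requires the coefficients to sum to zero. -/
theorem vietorisRips_cycles (r : ℝ) {n : ℕ} (hn : n ≠ 0) :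
    (vietorisRips Y r).cycles F n =
      CliqueChains.cycles F (fun x y : Y => dist x y ≤ r) Set.univ (n + 1) := by
  obtain ⟨n, rfl⟩ := Nat.exists_eq_succ_of_ne_zero hn
  change (vietorisRips Y r).chains F (n + 1) ⊓ _ = CliqueChains.chains F _ Set.univ (n + 2) ⊓ _
  rw [vietorisRips_chains]
  rfl

variable [Finite Y] {k : ℕ}

/-- On at most `2 k + 2` points, the Vietoris–Rips complex has degree `k` homology only if it is the
boundary of a cross-polytope. -/
theorem vrPersistentHomology_eq_zero (hk : k ≠ 0) (hcard : Nat.card Y ≤ 2 * k + 2) {r : ℝ}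
    (hr : ¬(Nat.card Y = 2 * k + 2 ∧ ∀ v : Y, ∃! w, r < dist v w))
    (x : (vrPersistentHomology F k Y).space r) : x = 0 := by
  obtain ⟨z, hz, rfl⟩ := PreAbstractSimplicialComplex.exists_homologyClass_eq x
  refine (PreAbstractSimplicialComplex.homologyClass_eq_zero_iff hz).2 ?_
  rw [vietorisRips_boundaries]
  rw [vietorisRips_cycles F r hk] at hz
  rcases lt_or_ge r 0 with hr0 | hr0
  -- At negative scales the relation is not reflexive, so the clique lemmas do not apply, but then
  -- there are no nonzero chains.
  · have : z = 0 := by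
      have h := CliqueChains.cycles_le_chains hz
      rw [CliqueChains.chains, Finsupp.mem_supported] at h
      rw [← Finsupp.support_eq_empty, Finset.eq_empty_iff_forall_notMem]
      exact fun t ht => absurd ((h ht).2 0 0) (not_le.2 (hr0.trans_le dist_nonneg))
    rw [this]
    exact Submodule.zero_mem _
  · by_contra hzb
    have := CliqueChains.crossPolytope_of_not_mem_boundaries (fun x => by simpa using hr0)
      (fun x y h => by rwa [dist_comm]) (by rw [Set.ncard_univ]; omega) hz hzb
    simp only [Set.ncard_univ, Set.mem_univ, true_and, not_le, forall_true_left] at this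
    exact hr ⟨by omega, this.2⟩

/-- The Vietoris–Rips persistent homology of a space in which each point has an opposite: birth is
the largest distance between non-opposite points, death the smallest between opposite ones. -/
theorem vrPersistentHomology_isSpannedOn (hk : k ≠ 0) (hcard : Nat.card Y = 2 * k + 2)
    (σ : Y → Y) {b d : ℝ} (hbd : b < d) (hb : ∀ v w, w ≠ σ v → dist v w ≤ b)
    (hb' : ∃ v w, w ≠ σ v ∧ dist v w = b) (hd : ∀ v, d ≤ dist v (σ v))
    (hd' : ∃ v, dist v (σ v) = d) :
    ∃ g, (vrPersistentHomology F k Y).IsSpannedOn b d g := by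
  classical
  -- The graph does not change on `[b, d)`, so a single cycle `z` serves at all these scales.
  have hrel : ∀ r, b ≤ r → r < d →
      (fun x y : Y => dist x y ≤ r) = fun x y : Y => y ≠ σ x := by
    intro r hbr hrd
    funext x y
    refine propext ⟨?_, fun h => (hb x y h).trans hbr⟩
    rintro h rfl
    exact absurd (h.trans_lt hrd) (not_lt.2 (hd x))
  have hb0 : 0 ≤ b := by
    obtain ⟨v, w, -, h⟩ := hb'
    exact h ▸ dist_nonneg
  have hrefl : ∀ x : Y, x ≠ σ x := fun x => by
    have := congrFun (congrFun (hrel b le_rfl hbd) x) x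
    exact this.mp (by simpa using hb0)
  have hsymm : ∀ x y : Y, y ≠ σ x → x ≠ σ y := fun x y h => by
    have h1 := congrFun (congrFun (hrel b le_rfl hbd) x) y
    have h2 := congrFun (congrFun (hrel b le_rfl hbd) y) x
    refine h2.mp ?_
    rw [dist_comm]
    exact h1.mpr h
  have hcard' : (Set.univ : Set Y).ncard = 2 * (k + 1) := by rw [Set.ncard_univ]; omega
  obtain ⟨z, hz, hzb⟩ := CliqueChains.exists_cycle_of_crossPolytope (F := F) hrefl hsymm (k + 1)
    Set.univ hcard' (fun v _ => ⟨σ v, ⟨trivial, fun h => h rfl⟩, fun w hw => not_not.1 hw.2⟩)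
  have hzr : ∀ r, b ≤ r → r < d → z ∈ (vietorisRips Y r).cycles F k := by
    intro r hbr hrd
    rw [vietorisRips_cycles F r hk, hrel r hbr hrd]
    exact hz
  refine ⟨fun r => PreAbstractSimplicialComplex.homologyClass (vietorisRips Y r) k z, hbd,
    ?_, ?_, ?_, ?_⟩
  · intro r hbr hrd h0
    have h1 := (PreAbstractSimplicialComplex.homologyClass_eq_zero_iff (hzr r hbr hrd)).1 h0
    rw [vietorisRips_boundaries, hrel r hbr hrd] at h1
    exact hzb h1
  · intro r hbr hrd x
    obtain ⟨y, hy, rfl⟩ := PreAbstractSimplicialComplex.exists_homologyClass_eq x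
    have hy' := hy
    rw [vietorisRips_cycles F r hk, hrel r hbr hrd] at hy'
    obtain ⟨a, c, hac, hmem⟩ := CliqueChains.exists_smul_add_smul_mem_boundaries hrefl hsymm (k + 1)
      Set.univ hcard'.le y hy' z hz
    -- Otherwise the relation would make a nonzero multiple of `z` a boundary.
    have ha : a ≠ 0 := by
      rintro rfl
      have hc : c ≠ 0 := by simpa using hac
      rw [zero_smul, zero_add] at hmem
      exact hzb ((Submodule.smul_mem_iff _ hc).1 hmem)
    refine ⟨-(a⁻¹ * c), PreAbstractSimplicialComplex.smul_homologyClass_eq (hzr r hbr hrd) hy ?_⟩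
    rw [vietorisRips_boundaries, hrel r hbr hrd]
    have h1 := Submodule.smul_mem _ (-a⁻¹) hmem
    convert h1 using 1
    rw [smul_add, smul_smul, smul_smul, neg_mul, inv_mul_cancel₀ ha, neg_smul, neg_smul, one_smul,
      neg_mul, neg_smul]
    abel
  · intro r s hrs hbr hsd
    exact PreAbstractSimplicialComplex.homologyMap_homologyClass (vietorisRips_mono Y hrs)
      (hzr r hbr (hrs.trans_lt hsd))
  · intro r hr x
    refine vrPersistentHomology_eq_zero F hk hcard.le ?_ x
    rintro ⟨-, huniq⟩
    -- For `r ≥ d` a closest opposite pair has become adjacent, leaving a point with no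
    -- non-neighbour; for `r < b` some point has two.
    by_cases hbr : b ≤ r
    · have hdr : d ≤ r := not_lt.1 fun h => hr ⟨hbr, h⟩
      obtain ⟨v, hv⟩ := hd'
      obtain ⟨w, hw, -⟩ := huniq v
      by_cases hwv : w = σ v
      · rw [hwv, hv] at hw
        exact absurd hw (not_lt.2 hdr)
      · exact absurd (hw.trans_le (hb v w hwv)) (not_lt.2 hbr)
    · push Not at hbr
      obtain ⟨v, w, hwv, hvw⟩ := hb'
      refine hwv ((huniq v).unique (hvw ▸ hbr) ?_)
      exact (hbr.trans hbd).trans_le (hd v)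

/-- One scale with unique non-neighbours suffices: it lies at or above all non-opposite distances
and strictly below all opposite ones. -/
theorem exists_opposite (hcard : 2 ≤ Nat.card Y) {r : ℝ}
    (h : ∀ v : Y, ∃! w, r < dist v w) :
    ∃ (σ : Y → Y) (b d : ℝ), b < d ∧ (∀ v w, w ≠ σ v → dist v w ≤ b) ∧
      (∃ v w, w ≠ σ v ∧ dist v w = b) ∧ (∀ v, d ≤ dist v (σ v)) ∧ ∃ v, dist v (σ v) = d := by
  have : Nontrivial Y := Finite.one_lt_card_iff_nontrivial.1 (by omega)
  choose σ hσ huniq using h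
  obtain ⟨v₀⟩ : Nonempty Y := inferInstance
  obtain ⟨v₁, hv₁⟩ := Finite.exists_min fun v => dist v (σ v)
  obtain ⟨w₀, hw₀⟩ := exists_ne (σ v₀)
  obtain ⟨q, hq, hmax⟩ := Set.exists_max_image {q : Y × Y | q.2 ≠ σ q.1} (fun q => dist q.1 q.2)
    (Set.toFinite _) ⟨(v₀, w₀), hw₀⟩
  refine ⟨σ, dist q.1 q.2, dist v₁ (σ v₁), ?_, fun v w hw => hmax (v, w) hw, ⟨q.1, q.2, hq, rfl⟩,
    hv₁, ⟨v₁, rfl⟩⟩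
  refine lt_of_le_of_lt (not_lt.1 fun h => hq ?_) (hσ v₁)
  exact huniq _ _ h

end VietorisRips

/-! ## Configurations of points on the circle -/

section Circle

open Real

theorem norm_coe_le_abs (x : ℝ) : ‖(x : AddCircle (2 * π))‖ ≤ |x| := by
  by_cases h : |x| ≤ |2 * π| / 2
  · exact ((AddCircle.norm_coe_eq_abs_iff _ two_pi_pos.ne').2 h).le
  · exact (AddCircle.norm_le_half_period _ two_pi_pos.ne').trans (not_le.1 h).le

theorem norm_coe_eq_abs {x : ℝ} (h : |x| ≤ π) : ‖(x : AddCircle (2 * π))‖ = |x| := by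
  refine (AddCircle.norm_coe_eq_abs_iff _ two_pi_pos.ne').2 ?_
  rwa [abs_of_pos two_pi_pos, mul_div_cancel_left₀ _ two_ne_zero]

theorem norm_le_pi (x : AddCircle (2 * π)) : ‖x‖ ≤ π := by
  have := AddCircle.norm_le_half_period (2 * π) (x := x) two_pi_pos.ne'
  rwa [abs_of_pos two_pi_pos, mul_div_cancel_left₀ _ two_ne_zero] at this

theorem norm_coe_sub_period (x : ℝ) :
    ‖((x - 2 * π : ℝ) : AddCircle (2 * π))‖ = ‖(x : AddCircle (2 * π))‖ := by
  rw [AddCircle.coe_sub, AddCircle.coe_period, sub_zero]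

theorem norm_coe_neg (x : ℝ) :
    ‖((-x : ℝ) : AddCircle (2 * π))‖ = ‖(x : AddCircle (2 * π))‖ := by
  rw [AddCircle.coe_neg, norm_neg]

theorem norm_coe_eq_two_pi_sub {x : ℝ} (h₁ : π ≤ x) (h₂ : x ≤ 2 * π) :
    ‖(x : AddCircle (2 * π))‖ = 2 * π - x := by
  rw [← norm_coe_sub_period, norm_coe_eq_abs, abs_of_nonpos] <;> [ring; linarith; skip]
  rw [abs_of_nonpos] <;> linarith

theorem norm_coe_le_two_pi_sub {x : ℝ} (h : x ≤ 2 * π) :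
    ‖(x : AddCircle (2 * π))‖ ≤ 2 * π - x := by
  rw [← norm_coe_sub_period]
  refine (norm_coe_le_abs _).trans ?_
  rw [abs_of_nonpos] <;> linarith

theorem norm_coe_cases {x : ℝ} (h : |x| ≤ 2 * π) :
    ‖(x : AddCircle (2 * π))‖ = |x| ∨ ‖(x : AddCircle (2 * π))‖ = 2 * π - |x| := by
  rcases le_total |x| π with hx | hx
  · exact Or.inl (norm_coe_eq_abs hx)
  · right
    rcases abs_cases x with ⟨hx', _⟩ | ⟨hx', _⟩
    · rw [hx', norm_coe_eq_two_pi_sub] <;> linarith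
    · rw [hx', ← norm_coe_neg, norm_coe_eq_two_pi_sub] <;> linarith

/-- An interval containing `2 j + 1` points `x a`, each with a companion `y a` that is closer than
`ε` to `x a` but at least `ε` away from all other points and from the ends, has length at least
`(2 j + 2) ε`. -/
theorem packing_bound {ι : Type*} [DecidableEq ι] {ε s : ℝ} (x y : ι → ℝ) (j : ℕ) :
    ∀ (t : ℝ) (A : Finset ι), (∀ a ∈ A, t ≤ x a ∧ x a ≤ s) → 2 * j + 1 ≤ A.card →
      (∀ a ∈ A, |y a - x a| < ε) → (∀ a ∈ A, ε ≤ |y a - t| ∧ ε ≤ |y a - s|) →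
      (∀ a ∈ A, ∀ a' ∈ A, a' ≠ a → ε ≤ |y a - x a'|) → (2 * j + 2) * ε ≤ s - t := by
  induction j with
  | zero =>
    intro t A hA hcard hclose hfar _
    obtain ⟨a, ha⟩ := Finset.card_pos.1 (show 0 < A.card by omega)
    have h1 := abs_lt.1 (hclose a ha)
    have h2 := hA a ha
    obtain ⟨h3, h4⟩ := hfar a ha
    rcases le_abs'.1 h3 with h3 | h3 <;> rcases le_abs'.1 h4 with h4 | h4 <;>
      push_cast <;> linarith
  | succ j ih =>
    intro t A hA hcard hclose hfar hpair
    -- For the two leftmost points, `y a` lies at least `ε` to the right of `t` and `ε` to the left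
    -- of `x a'`. This uses up length `2 ε`, and the induction continues from `x a'`.
    obtain ⟨a, ha, hmin⟩ := A.exists_min_image x (Finset.card_pos.1 (by omega))
    have hc1 := Finset.card_erase_of_mem ha
    obtain ⟨a', ha', hmin'⟩ := (A.erase a).exists_min_image x (Finset.card_pos.1 (by omega))
    have hc2 := Finset.card_erase_of_mem ha'
    have haA := Finset.mem_of_mem_erase ha'
    have hsub : ∀ c ∈ (A.erase a).erase a', c ∈ A := fun c hc =>
      Finset.mem_of_mem_erase (Finset.mem_of_mem_erase hc)
    have hrec := ih (x a') ((A.erase a).erase a')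
      (fun c hc => ⟨hmin' c (Finset.mem_of_mem_erase hc), (hA c (hsub c hc)).2⟩) (by omega)
      (fun c hc => hclose c (hsub c hc))
      (fun c hc => ⟨hpair c (hsub c hc) a' haA (Finset.ne_of_mem_erase hc).symm,
        (hfar c (hsub c hc)).2⟩)
      (fun c hc c' hc' => hpair c (hsub c hc) c' (hsub c' hc'))
    have h1 := abs_lt.1 (hclose a ha)
    have h2 := hA a ha
    have h3 := (hfar a ha).1
    have h4 := hpair a ha a' haA (Finset.ne_of_mem_erase ha')
    have h5 := hmin a' haA
    push_cast
    rcases le_abs'.1 h3 with h3 | h3 <;> rcases le_abs'.1 h4 with h4 | h4 <;> linarith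

/-! ### The lower bound on opposite distances -/

section LowerBound

variable {Y : Type*} [MetricSpace Y] [Fintype Y] {k : ℕ}

/-- The lower bound on opposite distances, for points listed by their angles from `v`, with the
opposite of `v` in the upper half circle. -/
theorem mul_pi_sub_le_dist_of_angle (hk : Odd k) (hcard : Fintype.card Y = 2 * k + 2) (σ : Y → Y)
    {b d : ℝ} (hb0 : 0 ≤ b) (hbd : b < d) (hb : ∀ v w, w ≠ σ v → dist v w ≤ b)
    (hd : ∀ v, d ≤ dist v (σ v)) (e : Y → ℝ)
    (hdist : ∀ y z, dist y z = ‖((e y - e z : ℝ) : AddCircle (2 * π))‖)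
    (he : ∀ y, 0 ≤ e y ∧ e y < 2 * π) (v : Y) (hv : e v = 0) (hσv : e (σ v) ≤ π) :
    ((k : ℝ) + 1) * (π - b) ≤ dist v (σ v) := by
  classical
  have hinv : ∀ y, σ (σ y) = y := by
    intro y
    by_contra h
    have h1 := hb (σ y) y (Ne.symm h)
    rw [dist_comm] at h1
    linarith [hd y]
  have hdv : dist v (σ v) = e (σ v) := by
    rw [hdist, hv, zero_sub, norm_coe_neg, norm_coe_eq_abs] <;>
      rw [abs_of_nonneg (he _).1]
    exact hσv
  have hds : d ≤ e (σ v) := hdv ▸ hd v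
  have hvσ : v ≠ σ v := by
    intro h
    rw [← h, hv] at hds
    linarith
  have hne0 : ∀ y, y ≠ v → 0 < e y := by
    intro y hy
    refine lt_of_le_of_ne (he y).1 fun h0 => hy ?_
    rw [← dist_eq_zero, hdist, hv, ← h0]
    simp
  have hbounds : ∀ y, y ≠ v → y ≠ σ v → e y ≤ b ∨ 2 * π - b ≤ e y := by
    intro y hy hyσ
    have h1 := hb v y hyσ
    rw [hdist, hv, zero_sub, norm_coe_neg] at h1
    have h2 := he y
    rcases norm_coe_cases (x := e y) (by rw [abs_of_nonneg h2.1]; exact h2.2.le) with h3 | h3 <;>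
      rw [h3, abs_of_nonneg h2.1] at h1
    · exact Or.inl h1
    · right; linarith
  have hσne : ∀ y, y ≠ v → y ≠ σ v → σ y ≠ v ∧ σ y ≠ σ v := by
    refine fun y hy hyσ => ⟨?_, ?_⟩
    · rintro h
      exact hyσ (by rw [← h, hinv])
    · intro h
      exact hy (by rw [← hinv y, h, hinv])
  let A : Finset Y := Finset.univ.filter fun y => y ≠ v ∧ y ≠ σ v ∧ e y ≤ b
  let B : Finset Y := Finset.univ.filter fun y => y ≠ v ∧ y ≠ σ v ∧ ¬ e y ≤ b
  -- Two points of `B` lie on an arc of length at most `b < d`, so they are not opposite. Thus `σ`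
  -- sends `B` into `A`, and `A` holds at least half of the `2 k` remaining points.
  have hBA : B.card ≤ A.card := by
    refine Finset.card_le_card_of_injOn σ ?_ fun y _ z _ h => by rw [← hinv y, h, hinv]
    intro y hy
    have hy' : y ∈ B := hy
    obtain ⟨hy1, hy2, hy3⟩ := (Finset.mem_filter.1 hy').2
    have hσy := hσne y hy1 hy2
    refine Finset.mem_coe.2 (Finset.mem_filter.2 ⟨Finset.mem_univ _, hσy.1, hσy.2, ?_⟩)
    have h1 := (hbounds y hy1 hy2).resolve_left hy3
    refine (hbounds _ hσy.1 hσy.2).resolve_right fun h2 => ?_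
    have h3 := hd y
    rw [hdist] at h3
    have h4 := norm_coe_le_abs (e y - e (σ y))
    have h5 : |e y - e (σ y)| ≤ b := by
      rw [abs_le]
      constructor <;> linarith [he y, he (σ y)]
    linarith
  have hcardA : k ≤ A.card := by
    have h1 : ({v, σ v} : Finset Y).card = 2 := Finset.card_pair hvσ
    have h2 : (Finset.univ : Finset Y) ⊆ {v, σ v} ∪ (A ∪ B) := by
      intro y _
      simp only [A, B, Finset.mem_union, Finset.mem_insert, Finset.mem_singleton,
        Finset.mem_filter, Finset.mem_univ, true_and]
      tauto
    have h3 := (Finset.card_le_card h2).trans ((Finset.card_union_le _ _).trans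
      (Nat.add_le_add_left (Finset.card_union_le _ _) _))
    rw [Finset.card_univ, hcard, h1] at h3
    omega
  -- The companion of `y`: the antipode of `σ y`, lifted to the real angle near `e y`.
  let τ : Y → ℝ := fun y => if e y < e (σ y) then e (σ y) - π else e (σ y) + π
  have hτclose : ∀ y, |τ y - e y| < π - b := by
    intro y
    have h1 := hd y
    rw [hdist] at h1
    have h2 := he y
    have h3 := he (σ y)
    have h4 : |e y - e (σ y)| ≤ 2 * π := by
      rw [abs_le]
      constructor <;> linarith
    have h5 : d ≤ |e y - e (σ y)| ∧ |e y - e (σ y)| ≤ 2 * π - d := by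
      have h6 := norm_coe_le_abs (e y - e (σ y))
      have h7 := norm_le_pi ((e y - e (σ y) : ℝ) : AddCircle (2 * π))
      rcases norm_coe_cases h4 with h | h <;> constructor <;> linarith
    simp only [τ]
    split_ifs with hlt
    · rw [abs_of_neg (by linarith)] at h5
      rw [abs_lt]
      constructor <;> linarith
    · rw [abs_of_nonneg (by linarith)] at h5
      rw [abs_lt]
      constructor <;> linarith
  -- A point `w ≠ y` is within `b` of `σ y`, hence at least `π - b` from the antipode of `σ y`.
  have hτfar : ∀ y w, w ≠ y → π - b ≤ |τ y - e w| := by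
    intro y w hw
    have h1 := hb (σ y) w (by rwa [hinv])
    rw [hdist] at h1
    have hπ : ‖(π : AddCircle (2 * π))‖ = π := by
      rw [norm_coe_eq_abs] <;> rw [abs_of_pos pi_pos]
    have h2 := norm_coe_le_abs (τ y - e w)
    have h3 : π ≤ ‖((e (σ y) - e w : ℝ) : AddCircle (2 * π))‖ +
        ‖((τ y - e w : ℝ) : AddCircle (2 * π))‖ := by
      by_cases hlt : e y < e (σ y)
      · have h4 := norm_sub_le ((e (σ y) - e w : ℝ) : AddCircle (2 * π))
          ((τ y - e w : ℝ) : AddCircle (2 * π))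
        rw [← AddCircle.coe_sub] at h4
        simp only [τ, if_pos hlt] at h4 ⊢
        rwa [show e (σ y) - e w - (e (σ y) - π - e w) = π by ring, hπ] at h4
      · have h4 := norm_sub_le ((e (σ y) - e w : ℝ) : AddCircle (2 * π))
          ((τ y - e w : ℝ) : AddCircle (2 * π))
        rw [← AddCircle.coe_sub] at h4
        simp only [τ, if_neg hlt] at h4 ⊢
        rwa [show e (σ y) - e w - (e (σ y) + π - e w) = -π by ring, norm_coe_neg, hπ] at h4
    linarith
  obtain ⟨j, rfl⟩ := hk
  -- The interval ends `0` and `e (σ v)` are the angles of `v` and `σ v`, so the companions keep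
  -- their distance from them too.
  have hpack := packing_bound (ε := π - b) (s := e (σ v)) e τ j 0 A
    (fun y hy => ⟨(he y).1, ((Finset.mem_filter.1 hy).2.2.2.trans hbd.le).trans hds⟩) hcardA
    (fun y _ => hτclose y)
    (fun y hy => ⟨hv ▸ hτfar y v (Finset.mem_filter.1 hy).2.1.symm,
      hτfar y (σ v) (Finset.mem_filter.1 hy).2.2.1.symm⟩)
    (fun y _ w _ hw => hτfar y w hw)
  rw [hdv]
  push_cast
  linarith

/-- In a configuration of `2 k + 2` points on the circle, `k` odd, where non-opposite points are at
distance at most `b` and opposite points farther apart, opposite points are at distance at least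
`(k + 1) (π - b)`. -/
theorem mul_pi_sub_le_dist_opposite (hk : Odd k) (hcard : Fintype.card Y = 2 * k + 2)
    (f : Y → AddCircle (2 * π)) (hf : Isometry f) (σ : Y → Y)
    {b d : ℝ} (hb0 : 0 ≤ b) (hbd : b < d) (hb : ∀ v w, w ≠ σ v → dist v w ≤ b)
    (hd : ∀ v, d ≤ dist v (σ v)) (v : Y) :
    ((k : ℝ) + 1) * (π - b) ≤ dist v (σ v) := by
  have : Fact (0 < 2 * π) := ⟨two_pi_pos⟩
  let angle : AddCircle (2 * π) → ℝ := fun x => AddCircle.equivIco (2 * π) 0 x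
  have hangle : ∀ x, ((angle x : ℝ) : AddCircle (2 * π)) = x := fun x =>
    AddCircle.coe_equivIco
  have hmem : ∀ x, 0 ≤ angle x ∧ angle x < 2 * π := fun x => by
    have := (AddCircle.equivIco (2 * π) 0 x).2
    exact ⟨this.1, by simpa using this.2⟩
  have hzero : angle 0 = 0 := by
    have h := hangle 0
    rw [AddCircle.coe_eq_zero_iff_of_mem_Ico (a := angle 0) ?_] at h
    · exact h
    · exact hmem 0
  by_cases hle : angle (f (σ v) - f v) ≤ π
  · refine mul_pi_sub_le_dist_of_angle hk hcard σ hb0 hbd hb hd (fun y => angle (f y - f v))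
      (fun y z => ?_) (fun y => hmem _) v ?_ hle
    · rw [AddCircle.coe_sub, hangle, hangle, ← hf.dist_eq, dist_eq_norm]
      congr 1
      abel
    · simp [hzero]
  -- Reversing the orientation brings the opposite of `v` into the upper half circle.
  · refine mul_pi_sub_le_dist_of_angle hk hcard σ hb0 hbd hb hd (fun y => angle (f v - f y))
      (fun y z => ?_) (fun y => hmem _) v ?_ ?_
    · rw [AddCircle.coe_sub, hangle, hangle, ← hf.dist_eq, dist_comm, dist_eq_norm]
      congr 1
      abel
    · simp [hzero]
    · by_contra hle'
      have h0 : ((angle (f (σ v) - f v) + angle (f v - f (σ v)) : ℝ) : AddCircle (2 * π)) = 0 := by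
        rw [AddCircle.coe_add, hangle, hangle]
        abel
      obtain ⟨n, hn⟩ := (AddCircle.coe_eq_zero_iff _).1 h0
      rw [zsmul_eq_mul] at hn
      have h1 := hmem (f (σ v) - f v)
      have h2 := hmem (f v - f (σ v))
      have hn1 : (1 : ℝ) < n := by nlinarith [pi_pos]
      have hn2 : (n : ℝ) < 2 := by nlinarith [pi_pos]
      have hn1' : 1 < n := by exact_mod_cast hn1
      have hn2' : n < 2 := by exact_mod_cast hn2
      omega

end LowerBound

/-! ## Realization of the points of the region -/

/-- The angles of a configuration realizing birth `π - ε` and death `d`: the multiples of `ε` up to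
`k ε`, and their antipodes, except that the opposite of `0` is `d`. -/
noncomputable def realizingAngle (k : ℕ) (ε d : ℝ) : Fin (k + 1) × Bool → ℝ
  | (i, false) => i * ε
  | (i, true) => if i = 0 then d else π + i * ε

section Realization

variable {k : ℕ} {ε d : ℝ}

/-- The lower bound on `d` enters as `k ε ≤ d - ε`: a gap of `ε` remains between the last multiple
and the moved point. -/
theorem realizingAngle_bounds (hε : 0 < ε) (hd : ((k : ℝ) + 1) * ε ≤ d) (i : Fin (k + 1)) :
    0 ≤ (i : ℝ) * ε ∧ (i : ℝ) * ε ≤ d - ε ∧ (i ≠ 0 → ε ≤ (i : ℝ) * ε) := by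
  refine ⟨by positivity, ?_, fun hi => ?_⟩
  · have : (i : ℝ) ≤ k := by exact_mod_cast Nat.lt_succ_iff.1 i.2
    nlinarith
  · have : (1 : ℝ) ≤ (i : ℕ) := by exact_mod_cast Nat.one_le_iff_ne_zero.2 (Fin.val_ne_zero_iff.2 hi)
    nlinarith

theorem sep_of_ne (hε : 0 < ε) {i j : Fin (k + 1)} (hij : i ≠ j) :
    (i : ℝ) * ε + ε ≤ j * ε ∨ (j : ℝ) * ε + ε ≤ i * ε := by
  rcases lt_or_gt_of_ne hij with h | h
  · left
    have : ((i : ℕ) : ℝ) + 1 ≤ (j : ℕ) := by exact_mod_cast h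
    nlinarith
  · right
    have : ((j : ℕ) : ℝ) + 1 ≤ (i : ℕ) := by exact_mod_cast h
    nlinarith

theorem realizingAngle_mem (hε : 0 < ε) (hd : ((k : ℝ) + 1) * ε ≤ d) (hdπ : d ≤ π)
    (x : Fin (k + 1) × Bool) : 0 ≤ realizingAngle k ε d x ∧ realizingAngle k ε d x < 2 * π := by
  obtain ⟨i, _ | _⟩ := x
  · have := realizingAngle_bounds hε hd i
    simp only [realizingAngle]
    constructor <;> linarith
  · have := realizingAngle_bounds hε hd i
    simp only [realizingAngle]
    split_ifs <;> constructor <;> linarith [pi_pos]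

theorem realizingAngle_injective (hε : 0 < ε) (hd : ((k : ℝ) + 1) * ε ≤ d) (hdπ : d ≤ π) :
    Function.Injective fun x => (realizingAngle k ε d x : AddCircle (2 * π)) := by
  have hreal : Function.Injective (realizingAngle k ε d) := by
    rintro ⟨i, _ | _⟩ ⟨j, _ | _⟩ h
    all_goals
      have hi := realizingAngle_bounds hε hd i
      have hj := realizingAngle_bounds hε hd j
      simp only [realizingAngle] at h
      try split_ifs at h
    any_goals linarith
    · by_contra hne
      rcases sep_of_ne hε (i := i) (j := j) (fun h => hne (by rw [h])) with h' | h' <;> linarith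
    · simp_all
    · linarith [hj.2.2 ‹_›]
    · linarith [hi.2.2 ‹_›]
    · by_contra hne
      rcases sep_of_ne hε (i := i) (j := j) (fun h => hne (by rw [h])) with h' | h' <;> linarith
  have : Fact (0 < 2 * π) := ⟨two_pi_pos⟩
  intro x y h
  refine hreal ?_
  have hx := realizingAngle_mem hε hd hdπ x
  have hy := realizingAngle_mem hε hd hdπ y
  refine (AddCircle.coe_eq_coe_iff_of_mem_Ico (a := 0) ?_ ?_).1 h <;> rw [zero_add] <;> assumption

/-- Each point must be at least `ε` from the antipodes of its non-opposites. Distinct multiples of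
`ε` are separated by `ε`, and the antipode `π + d` of the moved point is at least `ε` beyond every
`π + j ε`. -/
theorem norm_realizingAngle_le (hε : 0 < ε) (hd : ((k : ℝ) + 1) * ε ≤ d) (hdπ : d ≤ π)
    (x y : Fin (k + 1) × Bool) (hxy : y ≠ (x.1, !x.2)) :
    ‖((realizingAngle k ε d x - realizingAngle k ε d y : ℝ) : AddCircle (2 * π))‖ ≤ π - ε := by
  have hsame : ∀ i j : Fin (k + 1), ‖((i * ε - j * ε : ℝ) : AddCircle (2 * π))‖ ≤ π - ε := by
    intro i j
    refine (norm_coe_le_abs _).trans (abs_le.2 ?_)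
    have hi := realizingAngle_bounds hε hd i
    have hj := realizingAngle_bounds hε hd j
    constructor <;> linarith
  have hmixed : ∀ i j : Fin (k + 1), i ≠ j →
      ‖((realizingAngle k ε d (j, true) - realizingAngle k ε d (i, false) : ℝ) :
        AddCircle (2 * π))‖ ≤ π - ε := by
    intro i j hij
    have hi := realizingAngle_bounds hε hd i
    have hj := realizingAngle_bounds hε hd j
    simp only [realizingAngle]
    split_ifs with h
    · have := hi.2.2 fun h' => hij (h'.trans h.symm)
      refine (norm_coe_le_abs _).trans (abs_le.2 ?_)
      constructor <;> linarith
    · rcases sep_of_ne hε hij with h' | h'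
      · refine (norm_coe_le_two_pi_sub ?_).trans ?_ <;> linarith
      · refine (norm_coe_le_abs _).trans (abs_le.2 ?_)
        constructor <;> linarith
  have hantipode : ∀ j : Fin (k + 1), ‖((π + j * ε - d : ℝ) : AddCircle (2 * π))‖ ≤ π - ε := by
    intro j
    have hj := realizingAngle_bounds hε hd j
    refine (norm_coe_le_abs _).trans (abs_le.2 ?_)
    constructor <;> linarith
  obtain ⟨i, _ | _⟩ := x <;> obtain ⟨j, _ | _⟩ := y
  · exact hsame i j
  · rw [← norm_coe_neg, neg_sub]
    exact hmixed i j fun h => hxy (by rw [h]; rfl)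
  · exact hmixed j i fun h => hxy (by rw [h]; rfl)
  · simp only [realizingAngle]
    split_ifs
    · have := realizingAngle_bounds hε hd i
      simp only [sub_self, AddCircle.coe_zero, norm_zero]
      linarith
    · rw [← norm_coe_neg, neg_sub]
      exact hantipode j
    · exact hantipode i
    · rw [add_sub_add_left_eq_sub]
      exact hsame i j

theorem norm_realizingAngle_opposite (hε : 0 < ε) (hd : ((k : ℝ) + 1) * ε ≤ d) (hdπ : d ≤ π)
    (x : Fin (k + 1) × Bool) :
    ‖((realizingAngle k ε d x - realizingAngle k ε d (x.1, !x.2) : ℝ) : AddCircle (2 * π))‖ =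
      if x.1 = 0 then d else π := by
  have hd0 : 0 ≤ d := le_trans (by positivity) hd
  have key : ∀ i : Fin (k + 1), ‖((realizingAngle k ε d (i, true) - realizingAngle k ε d (i, false) :
      ℝ) : AddCircle (2 * π))‖ = if i = 0 then d else π := by
    intro i
    simp only [realizingAngle]
    split_ifs with h
    · rw [h, Fin.val_zero, Nat.cast_zero, zero_mul, sub_zero, norm_coe_eq_abs] <;>
        rw [abs_of_nonneg hd0]
      exact hdπ
    · rw [add_sub_cancel_right, norm_coe_eq_abs] <;> rw [abs_of_pos pi_pos]
  obtain ⟨i, _ | _⟩ := x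
  · rw [← norm_coe_neg, neg_sub]
    exact key i
  · exact key i

end Realization

end Circle

/-! ## The Vietoris–Rips persistence set of the circle -/

section PersistenceSet

open Real

variable (F : Type*) [Field F] {k : ℕ}

/-- Parity of `k` plays no role in the realization, only in the lower bound. -/
theorem exists_hasDiagram_of_region (hk : k ≠ 0) {b d : ℝ} (h : ((k : ℝ) + 1) * (π - b) ≤ d)
    (hdπ : d ≤ π) (hbd : b < d) :
    ({(b, (d : WithTop ℝ))} : Multiset (ℝ × WithTop ℝ)) ∈
      vrPersistenceSet F (2 * k + 2) k (AddCircle (2 * π)) := by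
  classical
  have hε : 0 < π - b := by linarith
  let f : Fin (k + 1) × Bool → AddCircle (2 * π) := fun x => (realizingAngle k (π - b) d x : ℝ)
  have hf : Function.Injective f := realizingAngle_injective hε h hdπ
  let Y : Finset (AddCircle (2 * π)) := Finset.univ.image f
  have hcard : Y.card = 2 * k + 2 := by
    rw [Finset.card_image_of_injective _ hf, Finset.card_univ, Fintype.card_prod, Fintype.card_fin,
      Fintype.card_bool]
    ring
  let e : Fin (k + 1) × Bool ≃ Y := Equiv.ofBijective
    (fun x => ⟨f x, Finset.mem_image_of_mem f (Finset.mem_univ x)⟩)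
    ⟨fun x y hxy => hf (congrArg Subtype.val hxy), fun ⟨y, hy⟩ => by
      obtain ⟨x, -, rfl⟩ := Finset.mem_image.1 hy
      exact ⟨x, rfl⟩⟩
  have hdist : ∀ x y, dist (e x) (e y) =
      ‖((realizingAngle k (π - b) d x - realizingAngle k (π - b) d y : ℝ) :
        AddCircle (2 * π))‖ := by
    intro x y
    rw [AddCircle.coe_sub, ← dist_eq_norm]
    rfl
  let σ : Y → Y := fun y => e ((e.symm y).1, !(e.symm y).2)
  have hσ : ∀ x, σ (e x) = e (x.1, !x.2) := fun x => by simp only [σ, e.symm_apply_apply]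
  suffices hspan : ∃ g, (vrPersistentHomology F k Y).IsSpannedOn b d g by
    obtain ⟨g, hg⟩ := hspan
    exact ⟨Y, hcard.le, hg.hasDiagram⟩
  refine vrPersistentHomology_isSpannedOn F hk
    (by rw [Nat.card_eq_fintype_card, Fintype.card_coe, hcard]) σ hbd ?_ ?_ ?_ ?_
  · intro v w hw
    obtain ⟨x, rfl⟩ := e.surjective v
    obtain ⟨y, rfl⟩ := e.surjective w
    rw [hσ, e.injective.ne_iff] at hw
    rw [hdist]
    exact (norm_realizingAngle_le hε h hdπ x y hw).trans (by linarith)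
  -- Birth is attained by the angles `0` and `π + ε` with `ε = π - b`, whose shorter arc is `π - ε =
  -- b`; index `1` exists because `k ≠ 0`.
  · have h1 : (⟨1, by omega⟩ : Fin (k + 1)) ≠ 0 := by simp [Fin.ext_iff]
    refine ⟨e (0, false), e (⟨1, by omega⟩, true), ?_, ?_⟩
    · rw [hσ, e.injective.ne_iff]
      exact fun h => h1 (congrArg Prod.fst h)
    · have hb0 : 0 ≤ b := by
        have : (1 : ℝ) ≤ k := by exact_mod_cast Nat.one_le_iff_ne_zero.2 hk
        nlinarith
      rw [hdist, ← norm_coe_neg]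
      simp only [realizingAngle, if_neg h1, Fin.val_zero, Nat.cast_zero, zero_mul, zero_sub,
        neg_neg, Nat.cast_one, one_mul]
      rw [norm_coe_eq_two_pi_sub] <;> linarith
  · intro v
    obtain ⟨x, rfl⟩ := e.surjective v
    rw [hσ, hdist, norm_realizingAngle_opposite hε h hdπ]
    split_ifs
    exacts [le_rfl, hdπ]
  · refine ⟨e (0, false), ?_⟩
    rw [hσ, hdist, norm_realizingAngle_opposite hε h hdπ, if_pos rfl]

theorem zero_mem_vrPersistenceSet (hk : k ≠ 0) :
    (0 : Multiset (ℝ × WithTop ℝ)) ∈ vrPersistenceSet F (2 * k + 2) k (AddCircle (2 * π)) := by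
  refine ⟨∅, by simp, PersistenceModule.hasDiagram_zero fun r x => ?_⟩
  refine vrPersistentHomology_eq_zero F hk (by simp) ?_ x
  rintro ⟨h, -⟩
  simp at h

theorem vrPersistenceSet_circle (hk : Odd k) :
    vrPersistenceSet F (2 * k + 2) k (AddCircle (2 * π)) =
      {D | ∃ b d : ℝ, ((k : ℝ) + 1) * (π - b) ≤ d ∧ d ≤ π ∧ b ≤ d ∧ D = pointDiagram b d} := by
  ext D
  constructor
  · rintro ⟨Y, hY, hD⟩
    have hcardY : Nat.card Y = Y.card := by rw [Nat.card_eq_fintype_card, Fintype.card_coe]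
    by_cases hex : ∃ r, Nat.card Y = 2 * k + 2 ∧ ∀ v : Y, ∃! w, r < dist v w
    · obtain ⟨r, hcard, hr⟩ := hex
      obtain ⟨σ, b, d, hbd, hb, hb', hd, hd'⟩ := exists_opposite (by omega) hr
      obtain ⟨g, hg⟩ := vrPersistentHomology_isSpannedOn F hk.pos.ne' hcard σ hbd hb hb' hd hd'
      obtain ⟨v, hv⟩ := hd'
      obtain ⟨v', w', -, hvw⟩ := hb'
      refine ⟨b, d, ?_, ?_, hbd.le, ?_⟩
      · rw [← hv]
        exact mul_pi_sub_le_dist_opposite hk (by rwa [← Nat.card_eq_fintype_card])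
          (Subtype.val : Y → AddCircle (2 * π)) isometry_subtype_coe σ (hvw ▸ dist_nonneg) hbd hb
          hd v
      · rw [← hv, Subtype.dist_eq, dist_eq_norm]
        exact norm_le_pi _
      · rw [pointDiagram, if_pos hbd]
        exact hg.eq_of_hasDiagram hD
    -- Any diagonal point of the region represents the empty diagram; `(π, π)` is one for every `k`.
    · refine ⟨π, π, by simp [pi_pos.le], le_rfl, le_rfl, ?_⟩
      rw [pointDiagram, if_neg (lt_irrefl _)]
      exact hD.eq_zero fun r x => vrPersistentHomology_eq_zero F hk.pos.ne' (by omega)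
        (fun h => hex ⟨r, h⟩) x
  · rintro ⟨b, d, h, hdπ, -, rfl⟩
    rw [pointDiagram]
    split_ifs with hbd
    · exact exists_hasDiagram_of_region F hk.pos.ne' h hdπ hbd
    · exact zero_mem_vrPersistenceSet F hk.pos.ne'

theorem singleton_mem_vrPersistenceSet_circle (hk : Odd k) :
    {p : ℝ × ℝ | ({(p.1, (p.2 : WithTop ℝ))} : Multiset (ℝ × WithTop ℝ)) ∈
        vrPersistenceSet F (2 * k + 2) k (AddCircle (2 * π))} =
      {p : ℝ × ℝ | ((k : ℝ) + 1) * (π - p.1) ≤ p.2 ∧ p.2 ≤ π ∧ p.1 < p.2} := by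
  ext ⟨b, d⟩
  constructor
  · intro h
    have h' : ({(b, (d : WithTop ℝ))} : Multiset (ℝ × WithTop ℝ)) ∈
      vrPersistenceSet F (2 * k + 2) k (AddCircle (2 * π)) := h
    rw [vrPersistenceSet_circle F hk] at h'
    obtain ⟨b', d', h1, h2, -, h3⟩ := h'
    rw [pointDiagram] at h3
    split_ifs at h3 with hlt
    · obtain ⟨rfl, h4⟩ := Prod.mk.inj (Multiset.singleton_inj.1 h3)
      obtain rfl := WithTop.coe_injective h4
      exact ⟨h1, h2, hlt⟩
    · exact absurd h3 (Multiset.singleton_ne_zero _)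
  · rintro ⟨h1, h2, h3⟩
    exact exists_hasDiagram_of_region F hk.pos.ne' h1 h2 h3

/-! ### The triangle for `k = 1`, and the final statement -/

theorem mem_triangle_iff (p : ℝ × ℝ) :
    p ∈ convexHull ℝ ({(2 * π / 3, 2 * π / 3), (π / 2, π), (π, π)} : Set (ℝ × ℝ)) ↔
      2 * (π - p.1) ≤ p.2 ∧ p.2 ≤ π ∧ p.1 ≤ p.2 := by
  constructor
  · intro hp
    let T : Set (ℝ × ℝ) := {p | 2 * (π - p.1) ≤ p.2 ∧ p.2 ≤ π ∧ p.1 ≤ p.2}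
    have hT : Convex ℝ T := by
      rintro ⟨x, y⟩ ⟨h1, h2, h3⟩ ⟨x', y'⟩ ⟨h1', h2', h3'⟩ s t hs ht hst
      simp only at h1 h2 h3 h1' h2' h3'
      obtain rfl : t = 1 - s := by linarith
      refine ⟨?_, ?_, ?_⟩ <;>
        simp only [Prod.fst_add, Prod.snd_add, Prod.smul_fst, Prod.smul_snd, smul_eq_mul] <;>
        nlinarith
    refine convexHull_min ?_ hT hp
    have := pi_pos
    rintro q (rfl | rfl | rfl) <;> refine ⟨?_, ?_, ?_⟩ <;> simp only <;> linarith
  · obtain ⟨b, d⟩ := p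
    rintro ⟨h1, h2, h3⟩
    simp only at h1 h2 h3
    have hπ := pi_pos
    have hconv := convex_convexHull ℝ
      ({(2 * π / 3, 2 * π / 3), (π / 2, π), (π, π)} : Set (ℝ × ℝ))
    have hsub := subset_convexHull ℝ
      ({(2 * π / 3, 2 * π / 3), (π / 2, π), (π, π)} : Set (ℝ × ℝ))
    -- The barycentric coordinates: each is the slack in one of the three inequalities, scaled to
    -- equal `1` at the opposite vertex.
    have hmem := hconv.sum_mem (t := Finset.univ)
      (w := ![3 * (π - d) / π, 2 * (d - b) / π, (d + 2 * b - 2 * π) / π])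
      (z := ![(2 * π / 3, 2 * π / 3), (π / 2, π), (π, π)]) ?_ ?_ ?_
    · convert hmem using 1
      simp only [Fin.sum_univ_three, Matrix.cons_val_zero, Matrix.cons_val_one, Matrix.cons_val,
        Prod.smul_mk, smul_eq_mul, Prod.mk_add_mk, Prod.mk.injEq]
      constructor <;> field_simp <;> ring
    · intro i _
      fin_cases i <;> simp <;> apply div_nonneg <;> linarith
    · simp only [Fin.sum_univ_three, Matrix.cons_val_zero, Matrix.cons_val_one, Matrix.cons_val]
      field_simp
      ring
    · intro i _
      fin_cases i <;> apply hsub <;> simp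

end PersistenceSet

theorem theorem5p5 (F : Type*) [Field F] (k : ℕ) (hk : Odd k) :
    vrPersistenceSet F (2 * k + 2) k (AddCircle (2 * Real.pi)) =
      {D | ∃ b d : ℝ, ((k : ℝ) + 1) * (Real.pi - b) ≤ d ∧ d ≤ Real.pi ∧ b ≤ d ∧
        D = pointDiagram b d} ∧
    {p : ℝ × ℝ | ({(p.1, (p.2 : WithTop ℝ))} : Multiset (ℝ × WithTop ℝ)) ∈
        vrPersistenceSet F (2 * k + 2) k (AddCircle (2 * Real.pi))} =
      {p : ℝ × ℝ | ((k : ℝ) + 1) * (Real.pi - p.1) ≤ p.2 ∧ p.2 ≤ Real.pi ∧ p.1 < p.2} ∧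
    (k = 1 →
      {p : ℝ × ℝ | ({(p.1, (p.2 : WithTop ℝ))} : Multiset (ℝ × WithTop ℝ)) ∈
          vrPersistenceSet F 4 1 (AddCircle (2 * Real.pi))} =
        {p : ℝ × ℝ | p ∈ convexHull ℝ
          ({(2 * Real.pi / 3, 2 * Real.pi / 3), (Real.pi / 2, Real.pi), (Real.pi, Real.pi)} :
            Set (ℝ × ℝ)) ∧ p.1 < p.2}) := by
  refine ⟨vrPersistenceSet_circle F hk, singleton_mem_vrPersistenceSet_circle F hk, ?_⟩
  rintro rfl
  have h := singleton_mem_vrPersistenceSet_circle F hk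
  refine h.trans ?_
  ext p
  rw [Set.mem_ofPred_eq, Set.mem_ofPred_eq, mem_triangle_iff, Nat.cast_one,
    show (1 : ℝ) + 1 = 2 by norm_num]
  exact ⟨fun ⟨h1, h2, h3⟩ => ⟨⟨h1, h2, h3.le⟩, h3⟩, fun ⟨⟨h1, h2, _⟩, h3⟩ => ⟨h1, h2, h3⟩⟩
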